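/- Let $M>0$ and let $(\tilde X_t)_{t\in\mathbb N}$, $\mathbb N=\{0,1,2,\dots\}$, be a time-homogeneous Markov chain on a probability space $(\Omega,\mathcal F,\mathbb P)$ with state space $\mathcal X=[-M,\infty)$ and transition kernel $P$. Let $S_0$ be a real random variable independent of $\sigma(\tilde X_k : k\in\mathbb N)$, put $\tilde S_n=S_0+\sum_{k=1}^n\tilde X_k$, and fix $\underline\theta<0<\overline\theta$. Assume: (i) $E\tilde X_n^2<\infty$ for all $n\ge 1$; (ii) there are $\alpha,h>0$ such that $P(x,A)\ge \alpha\,\frac{1}{2h}\mathrm{Leb}([-h,h]\cap A)$ for all $x\in\mathcal X$ and all Borel sets $A\subseteq\mathcal X$; (iii) $\int_{\mathcal X}|x|\,P(z,dx)<\infty$ and $\int_{\mathcal X}x\,P(z,dx)=0$ for every $z\in\mathcal X$. Define $\tilde T_0=0$ and, for $n\in\mathbb N$, $$\tilde L_{n+1}=\min\{k>\tilde T_n:\ \tilde S_k>\overline\theta\},\qquad \tilde T_{n+1}=\min\{k>\tilde L_{n+1}:\ \tilde S_k<\underline\theta\}.$$ Then almost surely all $\tilde L_n,\tilde T_n$,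 $n\ge1$, are well-defined and finite. Put $$\tilde U_n=(\tilde X_{\tilde L_n},\tilde S_{\tilde L_n},\tilde X_{\tilde T_n},\tilde S_{\tilde T_n},\tilde T_n-\tilde L_n),\quad n\ge 1,$$ $$\tilde{\mathcal U}=(0,\infty)\times(\overline\theta,\infty)\times[-M,0)\times[\underline\theta-M,\underline\theta)\times(\mathbb N\setminus\{0\}).$$ Almost surely $\tilde U_n\in\tilde{\mathcal U}$ for all $n\ge2$, and $(\tilde U_n)_{n\ge2}$ is a time-homogeneous Markov chain on $\tilde{\mathcal U}$. There is a probability $\upsilon$ on $\mathcal B(\tilde{\mathcal U})$ such that $\mathrm{Law}(\tilde U_n)\to\upsilon$ in total variation at a geometric speed: there are $C$ and $\rho\in(0,1)$ with $|\mathbb P(\tilde U_n\in B)-\upsilon(B)|\le C\rho^n$ for all $n\ge2$ and all Borel $B\subseteq\mathbb R^4\times\mathbb N$ (where $\upsilon$ is extended by zero outside $\tilde{\mathcal U}$). Furthermore, for every measurable $\phi:\mathbb R^4\times\mathbb N\to\mathbb R$ that is bounded on $\tilde{\mathcal U}$, $$\frac1n\sum_{j=1}^n\phi(\tilde U_j)\to\int_{\tilde{\mathcal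 U}}\phi(u)\,\upsilon(du),\quad n\to\infty,$$ almost surely. -/

import Mathlib

open MeasureTheory ProbabilityTheory Filter Topology

namespace LevelCrossing

noncomputable section

/-- `Y` is, under `μ`, a time-homogeneous Markov chain with transition kernel `Q`
(with respect to its own past):
`μ (Y (n+1) ∈ B | Y 0, …, Y n) = Q (Y n, B)` almost surely, for each measurable `B`. -/
structure IsMarkovChain {Ω E : Type*} [MeasurableSpace Ω] [mE : MeasurableSpace E]
    (μ : Measure Ω) (Y : ℕ → Ω → E) (Q : Kernel E E) : Prop where
  measurable : ∀ n, Measurable (Y n)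
  markov : ∀ (n : ℕ) (B : Set E), MeasurableSet B →
    μ⟦Y (n + 1) ⁻¹' B | ⨆ i ∈ Set.Iic n, mE.comap (Y i)⟧ =ᵐ[μ] fun ω => (Q (Y n ω)).real B

/-- Minorization: there are `α, h > 0` with `P(x, A) ≥ α ℓ(A)` for all states `x` and all Borel
subsets `A` of the state space `[-M, ∞)`, where
`ℓ(A) = Leb([-h, h] ∩ A) / (2h)`. -/
def Minorized {M : ℝ} (P : Kernel (Set.Ici (-M)) (Set.Ici (-M))) : Prop :=
  ∃ α h : ℝ, 0 < α ∧ 0 < h ∧ ∀ (x : Set.Ici (-M)) (A : Set (Set.Ici (-M))), MeasurableSet A →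
    α * (1 / (2 * h) * volume.real (Set.Icc (-h) h ∩ (Subtype.val '' A))) ≤ (P x).real A

/-- From every state the next step is integrable with mean zero. -/
def ZeroMean {M : ℝ} (P : Kernel (Set.Ici (-M)) (Set.Ici (-M))) : Prop :=
  ∀ z : Set.Ici (-M), Integrable (fun x : Set.Ici (-M) => (x : ℝ)) (P z) ∧
    ∫ x : Set.Ici (-M), (x : ℝ) ∂(P z) = 0

/-- The walk `S n = S₀ + X 1 + ⋯ + X n` along one trajectory. -/
def walk (s₀ : ℝ) (x : ℕ → ℝ) (n : ℕ) : ℝ := s₀ + ∑ k ∈ Finset.Icc 1 n, x k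

/-- `min {k > t : s k > θ}`, equal to `⊤` if there is no such `k`. -/
def firstAbove (s : ℕ → ℝ) (θ : ℝ) (t : ℕ∞) : ℕ∞ :=
  ⨅ (k : ℕ) (_ : t < (k : ℕ∞) ∧ θ < s k), (k : ℕ∞)

/-- `min {k > t : s k < θ}`, equal to `⊤` if there is no such `k`. -/
def firstBelow (s : ℕ → ℝ) (θ : ℝ) (t : ℕ∞) : ℕ∞ :=
  ⨅ (k : ℕ) (_ : t < (k : ℕ∞) ∧ s k < θ), (k : ℕ∞)

/-- The down-crossing times: `T 0 = 0`, and `T (n+1)` is the first time below `θlo` after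
`L (n+1)`, the first time above `θhi` after `T n`. -/
def downTime (s : ℕ → ℝ) (θlo θhi : ℝ) : ℕ → ℕ∞
  | 0 => 0
  | n + 1 => firstBelow s θlo (firstAbove s θhi (downTime s θlo θhi n))

/-- The up-crossing times: `L (n+1)` is the first time above `θhi` after `T n`
(the value at `0` is a convention and plays no role). -/
def upTime (s : ℕ → ℝ) (θlo θhi : ℝ) : ℕ → ℕ∞
  | 0 => 0
  | n + 1 => firstAbove s θhi (downTime s θlo θhi n)

/-- The crossing data `U n = (X (L n), S (L n), X (T n), S (T n), T n - L n)` along one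
trajectory (meaningful when `L n` and `T n` are finite, in which case `L n < T n` for `n ≥ 1`). -/
def crossingData (s₀ : ℝ) (x : ℕ → ℝ) (θlo θhi : ℝ) (n : ℕ) : ℝ × ℝ × ℝ × ℝ × ℕ :=
  let s := walk s₀ x
  let l := (upTime s θlo θhi n).toNat
  let t := (downTime s θlo θhi n).toNat
  (x l, s l, x t, s t, t - l)

/-- The state space
`(0, ∞) × (θhi, ∞) × [-M, 0) × [θlo - M, θlo) × {1, 2, …}` of the crossing data. -/
def crossingSpace (M θlo θhi : ℝ) : Set (ℝ × ℝ × ℝ × ℝ × ℕ) :=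
  Set.Ioi 0 ×ˢ Set.Ioi θhi ×ˢ Set.Ico (-M) 0 ×ˢ Set.Ico (θlo - M) θlo ×ˢ Set.Ici 1

/-- The measures `ν n`, `n ≥ 2`, converge to `υ` in total variation at a geometric speed. -/
def GeometricTV {E : Type*} [MeasurableSpace E] (ν : ℕ → Measure E) (υ : Measure E) : Prop :=
  ∃ C ρ : ℝ, 0 < ρ ∧ ρ < 1 ∧ ∀ n : ℕ, 2 ≤ n → ∀ B : Set E, MeasurableSet B →
    |(ν n).real B - υ.real B| ≤ C * ρ ^ n

end

end LevelCrossing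

open scoped ENNReal

namespace Doeblin

noncomputable section

variable {E : Type*} [MeasurableSpace E]

/-- The averaging operator of a kernel on real functions. -/
def op (K : Kernel E E) (f : E → ℝ) (x : E) : ℝ := ∫ y, f y ∂(K x)

/-- The part of a kernel left over after removing the measure `ρ`. -/
def residual (K : Kernel E E) (ρ : Measure E) [IsFiniteMeasure ρ] (hle : ∀ x, ρ ≤ K x) :
    Kernel E E where
  toFun x := K x - ρ
  measurable' := by
    refine Measure.measurable_of_measurable_coe _ fun s hs => ?_
    simp_rw [Measure.sub_apply hs (hle _)]
    exact (K.measurable_coe hs).sub_const _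

theorem residual_add (K : Kernel E E) (ρ : Measure E) [IsFiniteMeasure ρ] (hle : ∀ x, ρ ≤ K x)
    (x : E) : residual K ρ hle x + ρ = K x :=
  Measure.sub_add_cancel_of_le (hle x)

/-- The successive images of `ν` under a kernel. -/
def pushIter (R : Kernel E E) (ν : Measure E) : ℕ → Measure E
  | 0 => ν
  | n + 1 => (pushIter R ν n).bind R


theorem pushIter_residual_univ (K : Kernel E E) [IsMarkovKernel K] (ν : Measure E)
    [IsProbabilityMeasure ν] (ε : ℝ≥0∞) [IsFiniteMeasure (ε • ν)] (hle : ∀ x, ε • ν ≤ K x)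
    (n : ℕ) : pushIter (residual K (ε • ν) hle) ν n Set.univ = (1 - ε) ^ n := by
  induction n with
  | zero => simp [pushIter]
  | succ n ih =>
    have h : ∀ x, residual K (ε • ν) hle x Set.univ = 1 - ε := fun x => by
      have : residual K (ε • ν) hle x = K x - ε • ν := rfl
      rw [this, Measure.sub_apply MeasurableSet.univ (hle x)]
      simp
    rw [pushIter, Measure.bind_apply MeasurableSet.univ (Kernel.aemeasurable _)]
    simp_rw [h]
    rw [lintegral_const, ih, pow_succ, mul_comm]

theorem exists_invariant (K : Kernel E E) [IsMarkovKernel K] (ν : Measure E)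
    [IsProbabilityMeasure ν] {ε : ℝ≥0∞} (hε0 : ε ≠ 0) (hε1 : ε ≤ 1) (hle : ∀ x, ε • ν ≤ K x) :
    ∃ π : Measure E, IsProbabilityMeasure π ∧ π.bind K = π ∧ ε • ν ≤ π := by
  have hεt : ε ≠ ∞ := ne_top_of_le_ne_top ENNReal.one_ne_top hε1
  have : IsFiniteMeasure (ε • ν) := ⟨by
    simpa using lt_top_iff_ne_top.2 hεt⟩
  set R := residual K (ε • ν) hle with hR
  set π : Measure E := Measure.sum fun n => ε • pushIter R ν n with hπ
  have hmass : π Set.univ = 1 := by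
    rw [hπ, Measure.sum_apply _ MeasurableSet.univ]
    simp only [Measure.smul_apply, smul_eq_mul, hR, pushIter_residual_univ]
    rw [ENNReal.tsum_mul_left, ENNReal.tsum_geometric,
      ENNReal.sub_sub_cancel ENNReal.one_ne_top hε1, ENNReal.mul_inv_cancel hε0 hεt]
  have : IsProbabilityMeasure π := ⟨hmass⟩
  have hzero : ε • ν ≤ π := Measure.le_sum (fun n => ε • pushIter R ν n) 0
  refine ⟨π, ‹_›, ?_, hzero⟩
  ext s hs
  rw [Measure.bind_apply hs (Kernel.aemeasurable _)]
  have h1 : ∀ x, K x s = R x s + ε * ν s := fun x => by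
    rw [← residual_add K (ε • ν) hle x]
    simp [hR]
  simp_rw [h1]
  rw [lintegral_add_right _ measurable_const, lintegral_const, hmass, mul_one, hπ,
    lintegral_sum_measure, Measure.sum_apply _ hs,
      tsum_eq_zero_add' (f := fun n => (ε • pushIter R ν n) s) ENNReal.summable, add_comm]
  congr 1
  refine tsum_congr fun n => ?_
  rw [lintegral_smul_measure, Measure.smul_apply, pushIter,
    Measure.bind_apply hs (Kernel.aemeasurable _)]

variable {K : Kernel E E} {ν : Measure E} {ε : ℝ≥0∞}

theorem measurable_op {f : E → ℝ} (hf : Measurable f) : Measurable (op K f) :=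
  (StronglyMeasurable.integral_kernel hf.stronglyMeasurable).measurable

theorem measurable_op_iterate {f : E → ℝ} (hf : Measurable f) (n : ℕ) :
    Measurable ((op K)^[n] f) := by
  induction n with
  | zero => exact hf
  | succ n ih => rw [Function.iterate_succ_apply']; exact measurable_op ih

theorem integrable_of_mem_Icc {μ : Measure E} [IsFiniteMeasure μ] {f : E → ℝ} (hf : Measurable f)
    {a b : ℝ} (h : ∀ x, f x ∈ Set.Icc a b) : Integrable f μ :=
  Integrable.of_mem_Icc a b hf.aemeasurable (ae_of_all _ h)

theorem integral_mem_Icc {μ : Measure E} [IsProbabilityMeasure μ] {f : E → ℝ} (hf : Measurable f)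
    {a b : ℝ} (h : ∀ x, f x ∈ Set.Icc a b) : ∫ x, f x ∂μ ∈ Set.Icc a b := by
  have hi := integrable_of_mem_Icc (μ := μ) hf h
  constructor
  · simpa using integral_mono (μ := μ) (integrable_const a) hi fun x => (h x).1
  · simpa using integral_mono (μ := μ) hi (integrable_const b) fun x => (h x).2

theorem le_integral_of_smul_le [IsMarkovKernel K] (hle : ∀ x, ε • ν ≤ K x) {f : E → ℝ}
    (hf : Measurable f) {b : ℝ} (h : ∀ x, f x ∈ Set.Icc 0 b) (x : E) :
    ε.toReal * ∫ y, f y ∂ν ≤ op K f x := by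
  have := integral_mono_measure (hle x) (ae_of_all _ fun y => (h y).1)
    (integrable_of_mem_Icc hf h)
  rwa [integral_smul_measure, smul_eq_mul] at this

theorem op_mem_Icc [IsMarkovKernel K] [IsProbabilityMeasure ν]
    (hle : ∀ x, ε • ν ≤ K x) {f : E → ℝ} (hf : Measurable f) {a b : ℝ}
    (h : ∀ x, f x ∈ Set.Icc a b) :
    ∃ a' b' : ℝ, b' - a' = (1 - ε.toReal) * (b - a) ∧ ∀ x, op K f x ∈ Set.Icc a' b' := by
  refine ⟨ε.toReal * ∫ y, f y ∂ν + (1 - ε.toReal) * a,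
    ε.toReal * ∫ y, f y ∂ν + (1 - ε.toReal) * b, by ring, fun x => ?_⟩
  have hi : ∀ μ : Measure E, IsProbabilityMeasure μ → Integrable f μ := fun μ _ =>
    integrable_of_mem_Icc hf h
  have h1 := le_integral_of_smul_le hle (hf.sub_const a) (b := b - a)
    (fun y => ⟨sub_nonneg.2 (h y).1, sub_le_sub_right (h y).2 a⟩) x
  have h2 := le_integral_of_smul_le hle (hf.const_sub b) (b := b - a)
    (fun y => ⟨sub_nonneg.2 (h y).2, sub_le_sub_left (h y).1 b⟩) x
  simp only [op] at h1 h2 ⊢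
  rw [integral_sub (hi _ inferInstance) (integrable_const _),
    integral_sub (hi _ inferInstance) (integrable_const _)] at h1
  rw [integral_sub (integrable_const _) (hi _ inferInstance),
    integral_sub (integrable_const _) (hi _ inferInstance)] at h2
  simp only [integral_const, probReal_univ, one_smul] at h1 h2
  constructor <;> linarith

theorem op_iterate_mem_Icc [IsMarkovKernel K] [IsProbabilityMeasure ν]
    (hle : ∀ x, ε • ν ≤ K x) {f : E → ℝ} (hf : Measurable f)
    {a b : ℝ} (h : ∀ x, f x ∈ Set.Icc a b) (n : ℕ) :
    ∃ a' b' : ℝ, b' - a' = (1 - ε.toReal) ^ n * (b - a) ∧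
      ∀ x, (op K)^[n] f x ∈ Set.Icc a' b' := by
  induction n with
  | zero => exact ⟨a, b, by simp, h⟩
  | succ n ih =>
    obtain ⟨a', b', hab, h'⟩ := ih
    obtain ⟨a'', b'', hab', h''⟩ := op_mem_Icc hle (measurable_op_iterate hf n) h'
    refine ⟨a'', b'', by rw [hab', hab]; ring, fun x => ?_⟩
    rw [Function.iterate_succ_apply']
    exact h'' x

theorem integral_bind {μ : Measure E} {f : E → ℝ} (hi : Integrable f (μ.bind K)) :
    ∫ x, f x ∂(μ.bind K) = ∫ x, op K f x ∂μ := by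
  have h : μ.bind K = (K ∘ₖ Kernel.const Unit μ) () := by
    rw [Kernel.comp_apply, Kernel.const_apply]
  rw [h] at hi ⊢
  rw [Kernel.integral_comp hi, Kernel.const_apply]
  rfl

theorem integral_op_iterate_of_bind [IsMarkovKernel K] [IsProbabilityMeasure ν]
    (hle : ∀ x, ε • ν ≤ K x) {m : ℕ → Measure E}
    (hprob : ∀ n, IsProbabilityMeasure (m n)) (hm : ∀ n, m (n + 1) = (m n).bind K) {f : E → ℝ}
    (hf : Measurable f) {a b : ℝ} (h : ∀ x, f x ∈ Set.Icc a b) (k n : ℕ) :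
    ∫ x, f x ∂(m (k + n)) = ∫ x, (op K)^[n] f x ∂(m k) := by
  induction n generalizing k with
  | zero => rfl
  | succ n ih =>
    obtain ⟨a', b', -, h'⟩ := op_iterate_mem_Icc hle hf h n
    rw [show k + (n + 1) = k + 1 + n by ring, ih, hm,
      integral_bind, Function.iterate_succ_apply']
    rw [← hm]
    exact integrable_of_mem_Icc (measurable_op_iterate hf n) h'

theorem integral_op_iterate_of_invariant [IsMarkovKernel K] [IsProbabilityMeasure ν]
    (hle : ∀ x, ε • ν ≤ K x) {π : Measure E} [IsProbabilityMeasure π] (hπ : π.bind K = π)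
    {f : E → ℝ} (hf : Measurable f) {a b : ℝ} (h : ∀ x, f x ∈ Set.Icc a b) (n : ℕ) :
    ∫ x, (op K)^[n] f x ∂π = ∫ x, f x ∂π :=
  (integral_op_iterate_of_bind hle (m := fun _ => π) (fun _ => inferInstance)
    (fun _ => hπ.symm) hf h 0 n).symm

theorem abs_sub_le_of_mem_Icc {a b x y c : ℝ} (h : b - a = c) (hx : x ∈ Set.Icc a b)
    (hy : y ∈ Set.Icc a b) : |x - y| ≤ c := by
  rw [abs_le]
  constructor <;> linarith [hx.1, hx.2, hy.1, hy.2]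

theorem abs_op_iterate_sub_le [IsMarkovKernel K] [IsProbabilityMeasure ν]
    (hle : ∀ x, ε • ν ≤ K x) {π : Measure E} [IsProbabilityMeasure π] (hπ : π.bind K = π)
    {f : E → ℝ} (hf : Measurable f) {a b : ℝ} (h : ∀ x, f x ∈ Set.Icc a b) (n : ℕ) (x : E) :
    |(op K)^[n] f x - ∫ y, f y ∂π| ≤ (1 - ε.toReal) ^ n * (b - a) := by
  obtain ⟨a', b', hab, h'⟩ := op_iterate_mem_Icc hle hf h n
  refine abs_sub_le_of_mem_Icc hab (h' x) ?_
  rw [← integral_op_iterate_of_invariant hle hπ hf h n]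
  exact integral_mem_Icc (measurable_op_iterate hf n) h'

/-- Geometric convergence of the laws of a chain with a Doeblin kernel. -/
theorem abs_measureReal_sub_le [IsMarkovKernel K] [IsProbabilityMeasure ν]
    (hle : ∀ x, ε • ν ≤ K x) {π : Measure E} [IsProbabilityMeasure π] (hπ : π.bind K = π)
    {m : ℕ → Measure E} (hprob : ∀ n, IsProbabilityMeasure (m n))
    (hm : ∀ n, m (n + 1) = (m n).bind K) {B : Set E} (hB : MeasurableSet B) (n : ℕ) :
    |(m n).real B - π.real B| ≤ (1 - ε.toReal) ^ n := by
  set f : E → ℝ := B.indicator fun _ => 1 with hf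
  have hfm : Measurable f := measurable_const.indicator hB
  have h : ∀ x, f x ∈ Set.Icc (0 : ℝ) 1 := fun x => by
    by_cases hx : x ∈ B <;> simp [hf, hx]
  obtain ⟨a', b', hab, h'⟩ := op_iterate_mem_Icc hle hfm h n
  have h1 : (m n).real B = ∫ x, (op K)^[n] f x ∂(m 0) := by
    rw [← integral_op_iterate_of_bind hle hprob hm hfm h 0 n, zero_add, hf,
      integral_indicator hB]
    simp
  have h2 : π.real B = ∫ x, (op K)^[n] f x ∂π := by
    rw [integral_op_iterate_of_invariant hle hπ hfm h, hf, integral_indicator hB]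
    simp
  rw [h1, h2]
  have := hprob 0
  exact abs_sub_le_of_mem_Icc (by rw [hab]; ring)
    (integral_mem_Icc (measurable_op_iterate hfm n) h')
    (integral_mem_Icc (measurable_op_iterate hfm n) h')

/-- A bounded harmonic function of a Doeblin kernel is constant. -/
theorem eq_integral_of_harmonic [IsMarkovKernel K] [IsProbabilityMeasure ν]
    (hle : ∀ x, ε • ν ≤ K x) (hε0 : ε ≠ 0) (hε1 : ε ≤ 1) {π : Measure E} [IsProbabilityMeasure π]
    (hπ : π.bind K = π) {f : E → ℝ} (hf : Measurable f) {a b : ℝ} (h : ∀ x, f x ∈ Set.Icc a b)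
    (hharm : ∀ x, op K f x = f x) (x : E) : f x = ∫ y, f y ∂π := by
  have hfix : ∀ n, (op K)^[n] f = f := fun n => Function.iterate_fixed (funext hharm) n
  have hr : 0 < ε.toReal := ENNReal.toReal_pos hε0 (ne_top_of_le_ne_top ENNReal.one_ne_top hε1)
  have hr1 : ε.toReal ≤ 1 := by simpa using ENNReal.toReal_mono ENNReal.one_ne_top hε1
  have hlim : Tendsto (fun n : ℕ => (1 - ε.toReal) ^ n * (b - a)) atTop (𝓝 0) := by
    simpa using (tendsto_pow_atTop_nhds_zero_of_lt_one (sub_nonneg.2 hr1)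
      (by linarith)).mul_const (b - a)
  have : |f x - ∫ y, f y ∂π| ≤ 0 := ge_of_tendsto' hlim fun n => by
    simpa [hfix n] using abs_op_iterate_sub_le hle hπ hf h n x
  exact sub_eq_zero.1 (abs_nonpos_iff.1 this)

/-- The Poisson equation of a Doeblin kernel has a bounded solution for bounded data. -/
theorem exists_poisson [IsMarkovKernel K] [IsProbabilityMeasure ν]
    (hle : ∀ x, ε • ν ≤ K x) (hε0 : ε ≠ 0) (hε1 : ε ≤ 1) {π : Measure E} [IsProbabilityMeasure π]
    (hπ : π.bind K = π) {f : E → ℝ} (hf : Measurable f) {a b : ℝ} (h : ∀ x, f x ∈ Set.Icc a b) :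
    ∃ (g : E → ℝ) (C : ℝ), Measurable g ∧ (∀ x, |g x| ≤ C) ∧
      ∀ x, g x - op K g x = f x - ∫ y, f y ∂π := by
  have hr : 0 < ε.toReal := ENNReal.toReal_pos hε0 (ne_top_of_le_ne_top ENNReal.one_ne_top hε1)
  have hr1 : ε.toReal ≤ 1 := by simpa using ENNReal.toReal_mono ENNReal.one_ne_top hε1
  set d : ℕ → E → ℝ := fun n x => (op K)^[n] f x - ∫ y, f y ∂π with hd
  have hdm : ∀ n, Measurable (d n) := fun n => (measurable_op_iterate hf n).sub_const _
  have hdb : ∀ n x, ‖d n x‖ ≤ (1 - ε.toReal) ^ n * (b - a) := fun n x =>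
    abs_op_iterate_sub_le hle hπ hf h n x
  have hsum : Summable fun n : ℕ => (1 - ε.toReal) ^ n * (b - a) :=
    (summable_geometric_of_lt_one (sub_nonneg.2 hr1) (by linarith)).mul_right _
  have hds : ∀ x, Summable fun n => d n x := fun x => Summable.of_norm_bounded hsum fun n => hdb n x
  have hdi : ∀ n (m : Measure E) [IsFiniteMeasure m], Integrable (d n) m := fun n m _ =>
    integrable_of_mem_Icc (hdm n) fun x => abs_le.1 (hdb n x)
  refine ⟨fun x => ∑' n, d n x, ∑' n : ℕ, (1 - ε.toReal) ^ n * (b - a), ?_, fun x => ?_,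
    fun x => ?_⟩
  · refine measurable_of_tendsto_metrizable (f := fun N x => ∑ n ∈ Finset.range N, d n x)
      (fun N => Finset.measurable_fun_sum _ fun n _ => hdm n) ?_
    exact tendsto_pi_nhds.2 fun x => (hds x).hasSum.tendsto_sum_nat
  · exact tsum_of_norm_bounded hsum.hasSum fun n => hdb n x
  · have h1 : op K (fun x => ∑' n, d n x) x = ∑' n, d (n + 1) x := by
      rw [op, ← integral_tsum_of_summable_integral_norm (fun n => hdi n _)]
      · refine tsum_congr fun n => ?_
        obtain ⟨a', b', -, h'⟩ := op_iterate_mem_Icc hle hf h n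
        simp only [hd, Function.iterate_succ_apply']
        rw [integral_sub (integrable_of_mem_Icc (measurable_op_iterate hf n) h')
          (integrable_const _)]
        simp [op]
      · refine Summable.of_nonneg_of_le (fun n => integral_nonneg fun y => norm_nonneg _)
          (fun n => ?_) hsum
        have := integral_mono (μ := K x) (hdi n _).norm (integrable_const _) (hdb n)
        simpa using this
    change (∑' n, d n x) - _ = _
    rw [h1, (hds x).tsum_eq_zero_add]
    simp [hd]

end

end Doeblin

namespace LevelCrossing

noncomputable section

/-- The trajectory of a process up to time `n`. -/
def past {Ω E : Type*} (Y : ℕ → Ω → E) (n : ℕ) (ω : Ω) (i : Set.Iic n) : E := Y i ω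

/-- The last index of `Set.Iic n`. -/
def lastIdx (n : ℕ) : Set.Iic n := ⟨n, Set.mem_Iic.2 le_rfl⟩

theorem measurable_past {Ω E : Type*} [MeasurableSpace Ω] [MeasurableSpace E] {Y : ℕ → Ω → E}
    (hY : ∀ n, Measurable (Y n)) (n : ℕ) : Measurable (past Y n) :=
  measurable_pi_lambda _ fun i => hY i

theorem measurableSet_past_preimage {Ω E : Type*} [mE : MeasurableSpace E] (Y : ℕ → Ω → E)
    (n : ℕ) {A : Set (Set.Iic n → E)} (hA : MeasurableSet A) :
    MeasurableSet[⨆ i ∈ Set.Iic n, mE.comap (Y i)] (past Y n ⁻¹' A) := by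
  have : Measurable[⨆ i ∈ Set.Iic n, mE.comap (Y i)] (past Y n) := by
    refine @measurable_pi_lambda _ _ _ (_) _ _ fun i => ?_
    refine Measurable.mono (comap_measurable (Y i)) ?_ le_rfl
    exact le_iSup₂ (f := fun j (_ : j ∈ Set.Iic n) => mE.comap (Y j)) i.1 i.2
  exact this hA

variable {Ω E : Type*} [MeasurableSpace Ω] [mE : MeasurableSpace E] {μ : Measure Ω}
  {Y : ℕ → Ω → E} {Q : Kernel E E} [IsMarkovKernel Q]

theorem IsMarkovChain.measure_inter [IsProbabilityMeasure μ]
    (hY : IsMarkovChain μ Y Q) (n : ℕ) {A : Set Ω}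
    (hA : MeasurableSet[⨆ i ∈ Set.Iic n, mE.comap (Y i)] A) {B : Set E} (hB : MeasurableSet B) :
    μ (A ∩ Y (n + 1) ⁻¹' B) = ∫⁻ ω in A, Q (Y n ω) B ∂μ := by
  have hle : (⨆ i ∈ Set.Iic n, mE.comap (Y i)) ≤ ‹MeasurableSpace Ω› :=
    iSup₂_le fun i _ => (hY.measurable i).comap_le
  have hA' := hle _ hA
  have hYB := hY.measurable (n + 1) hB
  have h1 : ∫ ω in A, (Y (n + 1) ⁻¹' B).indicator (fun _ => (1 : ℝ)) ω ∂μ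
      = ∫ ω in A, (Q (Y n ω)).real B ∂μ := by
    rw [← setIntegral_condExp hle ((integrable_const (1 : ℝ)).indicator hYB) hA]
    exact setIntegral_congr_ae hA' ((hY.markov n B hB).mono fun ω h _ => h)
  have hmeas : Measurable fun ω => Q (Y n ω) B := (Q.measurable_coe hB).comp (hY.measurable n)
  rw [setIntegral_indicator hYB, setIntegral_const, smul_eq_mul, mul_one] at h1
  simp only [measureReal_def] at h1
  rw [integral_toReal hmeas.aemeasurable (ae_of_all _ fun ω => measure_lt_top _ _)] at h1
  refine (ENNReal.toReal_eq_toReal_iff' (measure_ne_top _ _) ?_).1 h1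
  refine ne_top_of_le_ne_top ENNReal.one_ne_top ?_
  calc ∫⁻ ω in A, Q (Y n ω) B ∂μ ≤ ∫⁻ ω, 1 ∂μ :=
        (setLIntegral_le_lintegral _ _).trans (lintegral_mono fun ω => prob_le_one)
    _ = 1 := by simp

theorem IsMarkovChain.map_past [IsProbabilityMeasure μ]
    (hY : IsMarkovChain μ Y Q) (n : ℕ) :
    μ.map (fun ω => (past Y n ω, Y (n + 1) ω))
      = (μ.map (past Y n)) ⊗ₘ (Q.comap (fun p => p (lastIdx n)) (measurable_pi_apply _)) := by
  have hp := measurable_past hY.measurable n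
  have : IsFiniteMeasure (μ.map fun ω => (past Y n ω, Y (n + 1) ω)) :=
    Measure.isFiniteMeasure_map _ _
  refine Measure.ext_prod fun {A B} hA hB => ?_
  rw [Measure.map_apply (hp.prodMk (hY.measurable _)) (hA.prod hB),
    Measure.compProd_apply_prod hA hB, setLIntegral_map hA (Kernel.measurable_coe _ hB) hp]
  exact hY.measure_inter n (measurableSet_past_preimage Y n hA) hB

theorem IsMarkovChain.integral_step [IsProbabilityMeasure μ]
    (hY : IsMarkovChain μ Y Q) (n : ℕ)
    {G : (Set.Iic n → E) × E → ℝ} (hG : Measurable G) {a b : ℝ} (hb : ∀ p, G p ∈ Set.Icc a b) :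
    ∫ ω, G (past Y n ω, Y (n + 1) ω) ∂μ = ∫ ω, ∫ y, G (past Y n ω, y) ∂(Q (Y n ω)) ∂μ := by
  have hp := measurable_past hY.measurable n
  rw [← integral_map (f := G) (hp.prodMk (hY.measurable _)).aemeasurable
    hG.aestronglyMeasurable, hY.map_past n, Measure.integral_compProd, integral_map hp.aemeasurable]
  · rfl
  · exact (StronglyMeasurable.integral_kernel_prod_right'
      hG.stronglyMeasurable).aestronglyMeasurable
  · have : IsProbabilityMeasure (μ.map (past Y n)) :=
      Measure.isProbabilityMeasure_map hp.aemeasurable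
    exact Doeblin.integrable_of_mem_Icc hG hb

theorem IsMarkovChain.map_succ [IsProbabilityMeasure μ]
    (hY : IsMarkovChain μ Y Q) (n : ℕ) :
    μ.map (Y (n + 1)) = (μ.map (Y n)).bind Q := by
  ext B hB
  rw [Measure.map_apply (hY.measurable _) hB, Measure.bind_apply hB (Kernel.aemeasurable _),
    lintegral_map (Q.measurable_coe hB) (hY.measurable n)]
  have := hY.measure_inter n (A := Set.univ) MeasurableSet.univ hB
  simpa using this

/-- A sequence with bounded increments is `o(n)` if it is along the squares. -/
theorem tendsto_div_of_tendsto_sq {m : ℕ → ℝ} {c : ℝ} (hc : ∀ n, |m (n + 1) - m n| ≤ c)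
    (h : Tendsto (fun n : ℕ => m ((n + 1) ^ 2) / ((n + 1 : ℕ) : ℝ) ^ 2) atTop (𝓝 0)) :
    Tendsto (fun n : ℕ => m n / (n : ℝ)) atTop (𝓝 0) := by
  have hc0 : 0 ≤ c := (abs_nonneg _).trans (hc 0)
  have hd : ∀ n k, |m (n + k) - m n| ≤ k * c := fun n k => by
    induction k with
    | zero => simp
    | succ k ih =>
      have := abs_sub_le (m (n + (k + 1))) (m (n + k)) (m n)
      have h2 := hc (n + k)
      rw [← add_assoc] at this ⊢
      push_cast
      linarith
  have h' : Tendsto (fun n : ℕ => m (n ^ 2) / (n : ℝ) ^ 2) atTop (𝓝 0) :=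
    (tendsto_add_atTop_iff_nat 1).1 h
  have hsqrt : Tendsto Nat.sqrt atTop atTop := by
    refine tendsto_atTop.2 fun b => ?_
    filter_upwards [eventually_ge_atTop (b * b)] with n hn using Nat.le_sqrt.2 hn
  have h1 : Tendsto (fun n : ℕ => |m (n ^ 2) / (n : ℝ) ^ 2| + 2 * c / n) atTop (𝓝 0) := by
    simpa using h'.abs.add (tendsto_const_div_atTop_nhds_zero_nat (2 * c))
  refine squeeze_zero_norm' ?_ (h1.comp hsqrt)
  filter_upwards [eventually_ge_atTop 1] with n hn
  set k := Nat.sqrt n with hk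
  have hk1 : 1 ≤ k := Nat.le_sqrt.2 (by simpa using hn)
  have hkn : k ^ 2 ≤ n := Nat.sqrt_le' n
  obtain ⟨j, hj⟩ := Nat.exists_eq_add_of_le hkn
  have hj2 : j ≤ 2 * k := by
    have := Nat.sqrt_le_add n
    rw [← hk] at this
    nlinarith
  have hkpos : (0 : ℝ) < k := by exact_mod_cast hk1
  have hnpos : (0 : ℝ) < n := by exact_mod_cast hn
  have hkn' : (k : ℝ) ^ 2 ≤ n := by exact_mod_cast hkn
  have hj2' : (j : ℝ) ≤ 2 * k := by exact_mod_cast hj2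
  have h3 : |m n| ≤ |m (k ^ 2)| + 2 * k * c := by
    have := hd (k ^ 2) j
    rw [← hj] at this
    have h4 := abs_sub_abs_le_abs_sub (m n) (m (k ^ 2))
    nlinarith
  simp only [Function.comp, Real.norm_eq_abs, abs_div, abs_of_pos hnpos]
  rw [abs_of_nonneg (by positivity : (0 : ℝ) ≤ (k : ℝ) ^ 2)]
  calc |m n| / n ≤ (|m (k ^ 2)| + 2 * k * c) / (k : ℝ) ^ 2 := by gcongr
    _ = |m (k ^ 2)| / (k : ℝ) ^ 2 + 2 * c / k := by field_simp

/-- Second moments of order `n` make a process with bounded increments `o(n)` almost surely. -/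
theorem ae_tendsto_div_of_sq_le {m : ℕ → Ω → ℝ} (hm : ∀ n, Measurable (m n)) {c D : ℝ}
    (hc : ∀ n ω, |m (n + 1) ω - m n ω| ≤ c) (hint : ∀ n, Integrable (fun ω => m n ω ^ 2) μ)
    (hsq : ∀ n, ∫ ω, m n ω ^ 2 ∂μ ≤ D * n) :
    ∀ᵐ ω ∂μ, Tendsto (fun n : ℕ => m n ω / (n : ℝ)) atTop (𝓝 0) := by
  set r : ℕ → Ω → ℝ := fun n ω => m ((n + 1) ^ 2) ω / ((n + 1 : ℕ) : ℝ) ^ 2 with hr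
  have hrm : ∀ n, Measurable (r n) := fun n => (hm _).div_const _
  have hle : ∀ n, ∫⁻ ω, ENNReal.ofReal (r n ω ^ 2) ∂μ
      ≤ ENNReal.ofReal (D * (1 / ((n + 1 : ℕ) : ℝ) ^ 2)) := fun n => by
    have hi : Integrable (fun ω => r n ω ^ 2) μ := by
      simp only [hr, div_pow]
      exact (hint _).div_const _
    rw [← ofReal_integral_eq_lintegral_ofReal hi (ae_of_all _ fun ω => sq_nonneg _)]
    refine ENNReal.ofReal_le_ofReal ?_
    have hpos : (0 : ℝ) < ((n + 1 : ℕ) : ℝ) ^ 2 := by positivity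
    simp only [hr, div_pow]
    rw [integral_div, div_le_iff₀ (by positivity)]
    refine (hsq _).trans (le_of_eq ?_)
    push_cast
    field_simp
  have hfin : ∫⁻ ω, ∑' n, ENNReal.ofReal (r n ω ^ 2) ∂μ ≠ ∞ := by
    rw [lintegral_tsum fun n => ((hrm n).pow_const 2).ennreal_ofReal.aemeasurable]
    refine ne_top_of_le_ne_top ?_ (ENNReal.tsum_le_tsum hle)
    have hs : Summable fun n : ℕ => D * (1 / ((n + 1 : ℕ) : ℝ) ^ 2) :=
      ((summable_nat_add_iff 1).2 (Real.summable_one_div_nat_pow.2 one_lt_two)).mul_left D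
    exact hs.tsum_ofReal_ne_top
  have hae := ae_lt_top (Measurable.tsum fun n =>
    ((hrm n).pow_const 2).ennreal_ofReal) hfin
  filter_upwards [hae] with ω hω
  refine tendsto_div_of_tendsto_sq (fun n => hc n ω) ?_
  have h0 := ENNReal.tendsto_atTop_zero_of_tsum_ne_top hω.ne
  have h1 : Tendsto (fun n => r n ω ^ 2) atTop (𝓝 0) := by
    have := (ENNReal.tendsto_toReal ENNReal.zero_ne_top).comp h0
    refine this.congr fun n => ?_
    simp [ENNReal.toReal_ofReal (sq_nonneg _)]
  have h2 := h1.sqrt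
  simp only [Real.sqrt_sq_eq_abs, Real.sqrt_zero] at h2
  exact (tendsto_zero_iff_abs_tendsto_zero _).2 h2

theorem IsMarkovChain.ae_tendsto_martingale [IsProbabilityMeasure μ]
    (hY : IsMarkovChain μ Y Q) {g : E → ℝ}
    (hg : Measurable g) {C : ℝ} (hC : ∀ x, |g x| ≤ C) :
    ∀ᵐ ω ∂μ, Tendsto (fun n : ℕ =>
      (∑ j ∈ Finset.range n, (g (Y (j + 1) ω) - Doeblin.op Q g (Y j ω))) / (n : ℝ))
      atTop (𝓝 0) := by
  have hgI : ∀ x, g x ∈ Set.Icc (-C) C := fun x => abs_le.1 (hC x)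
  have hopm : Measurable (Doeblin.op Q g) := Doeblin.measurable_op hg
  have hop : ∀ x, |Doeblin.op Q g x| ≤ C := fun x =>
    abs_le.2 (Doeblin.integral_mem_Icc hg hgI)
  set d : ℕ → Ω → ℝ := fun j ω => g (Y (j + 1) ω) - Doeblin.op Q g (Y j ω) with hd
  have hdm : ∀ j, Measurable (d j) := fun j =>
    (hg.comp (hY.measurable _)).sub (hopm.comp (hY.measurable _))
  have hdb : ∀ j ω, |d j ω| ≤ 2 * C := fun j ω => by
    refine (abs_sub _ _).trans ?_
    linarith [hC (Y (j + 1) ω), hop (Y j ω)]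
  set m : ℕ → Ω → ℝ := fun n ω => ∑ j ∈ Finset.range n, d j ω with hm
  have hmm : ∀ n, Measurable (m n) := fun n => Finset.measurable_fun_sum _ fun j _ => hdm j
  have hmb : ∀ n ω, |m n ω| ≤ n * (2 * C) := fun n ω => by
    refine (Finset.abs_sum_le_sum_abs _ _).trans ((Finset.sum_le_sum fun j _ => hdb j ω).trans ?_)
    simp
  have hbd : ∀ {f : Ω → ℝ} {K : ℝ}, Measurable f → (∀ ω, |f ω| ≤ K) → Integrable f μ :=
    fun hf hK => Doeblin.integrable_of_mem_Icc hf fun ω => abs_le.1 (hK ω)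
  have hC0 : 0 ≤ C := by
    obtain ⟨ω⟩ : Nonempty Ω := nonempty_of_isProbabilityMeasure μ
    exact (abs_nonneg _).trans (hC (Y 0 ω))
  have hmsq : ∀ n, Integrable (fun ω => m n ω ^ 2) μ := fun n =>
    hbd (K := (n * (2 * C)) ^ 2) ((hmm n).pow_const 2) fun ω => by
      rw [abs_pow]
      exact pow_le_pow_left₀ (abs_nonneg _) (hmb n ω) 2
  have horth : ∀ n, ∫ ω, m n ω * d n ω ∂μ = 0 := fun n => by
    let H : (Set.Iic n → E) → ℝ := fun p => ∑ j : Fin n,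
      (g (p ⟨j + 1, j.2⟩) - Doeblin.op Q g (p ⟨j, j.2.le⟩))
    have hHm : Measurable H := Finset.measurable_fun_sum _ fun j _ =>
      (hg.comp (measurable_pi_apply _)).sub (hopm.comp (measurable_pi_apply _))
    have hHb : ∀ p, |H p| ≤ n * (2 * C) := fun p => by
      refine (Finset.abs_sum_le_sum_abs _ _).trans
        ((Finset.sum_le_sum fun j _ => (abs_sub _ _).trans (add_le_add (hC _) (hop _))).trans ?_)
      simp [two_mul, mul_add]
    have hH : ∀ ω, m n ω = H (past Y n ω) := fun ω => by
      simp only [hm, H, past, hd]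
      exact Finset.sum_range fun j => g (Y (j + 1) ω) - Doeblin.op Q g (Y j ω)
    have hGm : Measurable fun q : (Set.Iic n → E) × E =>
        H q.1 * (g q.2 - Doeblin.op Q g (q.1 (lastIdx n))) :=
      (hHm.comp measurable_fst).mul ((hg.comp measurable_snd).sub
        (hopm.comp ((measurable_pi_apply _).comp measurable_fst)))
    have := hY.integral_step n hGm (a := -(n * (2 * C) * (C + C))) (b := n * (2 * C) * (C + C))
      fun q => abs_le.1 (by
        rw [abs_mul]
        exact mul_le_mul (hHb _) ((abs_sub _ _).trans (add_le_add (hC _) (hop _)))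
          (abs_nonneg _) (by positivity))
    calc ∫ ω, m n ω * d n ω ∂μ
        = ∫ ω, H (past Y n ω) * (g (Y (n + 1) ω) - Doeblin.op Q g (past Y n ω (lastIdx n))) ∂μ := by
          simp_rw [hH]
          rfl
      _ = 0 := by
          rw [this]
          refine integral_eq_zero_of_ae (ae_of_all _ fun ω => ?_)
          simp only [Pi.zero_apply]
          rw [integral_const_mul, integral_sub (Doeblin.integrable_of_mem_Icc hg hgI)
            (integrable_const _)]
          simp [past, lastIdx, Doeblin.op]
  refine ae_tendsto_div_of_sq_le hmm (c := 2 * C) (D := (2 * C) ^ 2) (fun n ω => ?_) hmsq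
    fun n => ?_
  · simp only [Finset.sum_range_succ, add_sub_cancel_left]
    exact hdb n ω
  · induction n with
    | zero => simp
    | succ n ih =>
      have hmd : Integrable (fun ω => m n ω * d n ω) μ :=
        hbd (K := n * (2 * C) * (2 * C)) ((hmm n).mul (hdm n)) fun ω => by
          rw [abs_mul]
          exact mul_le_mul (hmb n ω) (hdb n ω) (abs_nonneg _) (by positivity)
      have hdsq : ∀ ω, d n ω ^ 2 ≤ (2 * C) ^ 2 := fun ω => by
        rw [← sq_abs]
        exact pow_le_pow_left₀ (abs_nonneg _) (hdb n ω) 2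
      have hdi : Integrable (fun ω => d n ω ^ 2) μ :=
        Doeblin.integrable_of_mem_Icc ((hdm n).pow_const 2) fun ω => ⟨sq_nonneg _, hdsq ω⟩
      have hexp : ∀ ω, m (n + 1) ω ^ 2 = m n ω ^ 2 + 2 * (m n ω * d n ω) + d n ω ^ 2 := fun ω => by
        simp only [hm, Finset.sum_range_succ]
        ring
      change ∫ ω, m (n + 1) ω ^ 2 ∂μ ≤ _
      replace ih : ∫ ω, m n ω ^ 2 ∂μ ≤ (2 * C) ^ 2 * n := ih
      simp_rw [hexp]
      have hmi : Integrable (fun ω => m n ω ^ 2 + 2 * (m n ω * d n ω)) μ :=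
        (hmsq n).add (hmd.const_mul 2)
      rw [integral_add hmi hdi,
        integral_add (hmsq n) (hmd.const_mul 2), integral_const_mul, horth n]
      have : ∫ ω, d n ω ^ 2 ∂μ ≤ (2 * C) ^ 2 := by
        simpa using integral_mono hdi (integrable_const _) hdsq
      push_cast
      linarith

/-- The strong law of large numbers for a chain with a Doeblin kernel. -/
theorem IsMarkovChain.strong_law [IsProbabilityMeasure μ]
    (hY : IsMarkovChain μ Y Q) {ν : Measure E}
    [IsProbabilityMeasure ν] {ε : ℝ≥0∞} (hle : ∀ x, ε • ν ≤ Q x) (hε0 : ε ≠ 0) (hε1 : ε ≤ 1)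
    {π : Measure E} [IsProbabilityMeasure π] (hπ : π.bind Q = π) {f : E → ℝ} (hf : Measurable f)
    {a b : ℝ} (h : ∀ x, f x ∈ Set.Icc a b) :
    ∀ᵐ ω ∂μ, Tendsto (fun n : ℕ => (∑ j ∈ Finset.range n, f (Y j ω)) / (n : ℝ)) atTop
      (𝓝 (∫ x, f x ∂π)) := by
  obtain ⟨g, C, hg, hC, hpois⟩ := Doeblin.exists_poisson hle hε0 hε1 hπ hf h
  filter_upwards [hY.ae_tendsto_martingale hg hC] with ω hω
  have hb : Tendsto (fun n : ℕ => (g (Y 0 ω) - g (Y n ω)) / (n : ℝ)) atTop (𝓝 0) := by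
    refine squeeze_zero_norm (fun n => ?_) (tendsto_const_div_atTop_nhds_zero_nat (C + C))
    rw [norm_div, Real.norm_eq_abs, Real.norm_natCast]
    gcongr
    exact (abs_sub _ _).trans (add_le_add (hC _) (hC _))
  have := (hω.add hb).add_const (∫ x, f x ∂π)
  rw [add_zero, zero_add] at this
  refine this.congr' ?_
  filter_upwards [eventually_ge_atTop 1] with n hn
  have hn0 : (n : ℝ) ≠ 0 := by positivity
  have key : ∀ n : ℕ, ∑ j ∈ Finset.range n, (g (Y (j + 1) ω) - Doeblin.op Q g (Y j ω))
      + (g (Y 0 ω) - g (Y n ω)) + n * ∫ x, f x ∂π = ∑ j ∈ Finset.range n, f (Y j ω) := fun n => by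
    induction n with
    | zero => simp
    | succ n ih =>
      rw [Finset.sum_range_succ, Finset.sum_range_succ, ← ih]
      push_cast
      linarith [hpois (Y n ω)]
  rw [← key n]
  field_simp

/-- The function `F` with its second argument restricted to `[0, ∞)`. -/
def trunc {E α : Type*} [Zero α] (F : E → ℝ → α) (y : E) (t : ℝ) : α := if 0 ≤ t then F y t else 0

section Trunc

variable {E : Type*} {F : E → ℝ → ℝ}

theorem measurable_trunc [MeasurableSpace E] {α : Type*} [MeasurableSpace α] [Zero α]
    {F : E → ℝ → α}
    (hF : Measurable fun p : E × ℝ => F p.1 p.2) :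
    Measurable fun p : E × ℝ => trunc F p.1 p.2 :=
  Measurable.ite (measurableSet_le measurable_const measurable_snd) hF measurable_const

theorem trunc_mem_Icc (h0 : ∀ x r, F x r ∈ Set.Icc (0 : ℝ) 1) (x : E) (r : ℝ) :
    trunc F x r ∈ Set.Icc (0 : ℝ) 1 := by
  unfold trunc
  split_ifs
  · exact h0 x r
  · simp

theorem monotone_trunc (h0 : ∀ x r, F x r ∈ Set.Icc (0 : ℝ) 1) (hmono : ∀ x, Monotone (F x))
    (x : E) : Monotone (trunc F x) := fun r r' h => by
  unfold trunc
  split_ifs with h1 h2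
  · exact hmono x h
  · exact absurd (h1.trans h) h2
  · exact (h0 x r').1
  · exact le_rfl

theorem tendsto_trunc (h0 : ∀ x r, F x r ∈ Set.Icc (0 : ℝ) 1) (hmono : ∀ x, Monotone (F x))
    (x : E) : Tendsto (trunc F x) atTop (𝓝 (⨆ r, F x r)) := by
  have hb : BddAbove (Set.range (F x)) := ⟨1, by rintro _ ⟨r, rfl⟩; exact (h0 x r).2⟩
  refine (tendsto_atTop_ciSup (hmono x) hb).congr' ?_
  filter_upwards [eventually_ge_atTop 0] with r hr
  rw [trunc, if_pos hr]

end Trunc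

section Fixed

variable {E : Type*} [MeasurableSpace E] {P : Kernel E E} {ν π : Measure E}
  [IsProbabilityMeasure ν] [IsProbabilityMeasure π] {ε : ℝ≥0∞} {ξ : E → ℝ} {F : E → ℝ → ℝ}

theorem iSup_eq_const_of_fixed [IsMarkovKernel P] (hle : ∀ x, ε • ν ≤ P x) (hε0 : ε ≠ 0)
    (hε1 : ε ≤ 1) (hπ : π.bind P = π) (hξ : Measurable ξ)
    (hF : Measurable fun p : E × ℝ => F p.1 p.2)
    (h0 : ∀ x r, F x r ∈ Set.Icc (0 : ℝ) 1) (hmono : ∀ x, Monotone (F x))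
    (hfix : ∀ x r, F x r = ∫ y, trunc F y (r - ξ y) ∂(P x)) :
    ∃ c : ℝ, ∀ x, ⨆ r, F x r = c := by
  have hb : ∀ x, BddAbove (Set.range (F x)) := fun x =>
    ⟨1, by rintro _ ⟨r, rfl⟩; exact (h0 x r).2⟩
  have hlim : ∀ x, Tendsto (fun n : ℕ => F x n) atTop (𝓝 (⨆ r, F x r)) := fun x =>
    (tendsto_atTop_ciSup (hmono x) (hb x)).comp tendsto_natCast_atTop_atTop
  have hGm : Measurable fun x => ⨆ r, F x r :=
    measurable_of_tendsto_metrizable (f := fun (n : ℕ) x => F x n)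
      (fun n => hF.comp (measurable_id.prodMk measurable_const)) (tendsto_pi_nhds.2 hlim)
  have hG : ∀ x, ⨆ r, F x r ∈ Set.Icc (0 : ℝ) 1 := fun x =>
    ⟨(h0 x 0).1.trans (le_ciSup (hb x) 0), ciSup_le fun r => (h0 x r).2⟩
  refine ⟨_, Doeblin.eq_integral_of_harmonic hle hε0 hε1 hπ hGm hG fun x => ?_⟩
  refine tendsto_nhds_unique ?_ (hlim x)
  simp_rw [hfix x]
  refine tendsto_integral_of_dominated_convergence (fun _ => 1) (fun n => ?_)
    (integrable_const _) (fun n => ae_of_all _ fun y => ?_) (ae_of_all _ fun y => ?_)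
  · exact ((measurable_trunc hF).comp
      (measurable_id.prodMk (hξ.const_sub _))).aestronglyMeasurable
  · have := trunc_mem_Icc h0 y (n - ξ y)
    rw [Real.norm_eq_abs, abs_of_nonneg this.1]
    exact this.2
  · exact (tendsto_trunc h0 hmono y).comp
      (tendsto_atTop_add_const_right _ (-ξ y) tendsto_natCast_atTop_atTop)

theorem integral_trunc_eq_of_fixed (hπ : π.bind P = π) (hξ : Measurable ξ)
    (hF : Measurable fun p : E × ℝ => F p.1 p.2) (h0 : ∀ x r, F x r ∈ Set.Icc (0 : ℝ) 1)
    (hfix : ∀ x r, F x r = ∫ y, trunc F y (r - ξ y) ∂(P x)) {r : ℝ} (hr : 0 ≤ r) :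
    ∫ y, trunc F y r ∂π = ∫ y, trunc F y (r - ξ y) ∂π := by
  have hT : Measurable fun y => trunc F y (r - ξ y) :=
    (measurable_trunc hF).comp (measurable_id.prodMk (hξ.const_sub _))
  have hi : Integrable (fun y => trunc F y (r - ξ y)) (π.bind P) := by
    rw [hπ]
    exact Doeblin.integrable_of_mem_Icc hT fun y => trunc_mem_Icc h0 _ _
  conv_rhs => rw [← hπ, Doeblin.integral_bind hi]
  refine integral_congr_ae (ae_of_all _ fun y => ?_)
  simp only [trunc, if_pos hr]
  exact hfix y r

/-- For a monotone fixed point of the survival equation, the mass near the barrier vanishes. -/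
theorem ae_eq_zero_of_fixed [IsMarkovKernel P] (hle : ∀ x, ε • ν ≤ P x) (hε0 : ε ≠ 0) (hε1 : ε ≤ 1)
    (hπ : π.bind P = π) (hξ : Measurable ξ) (hξi : Integrable ξ π) (hξ0 : ∫ y, ξ y ∂π = 0)
    (hF : Measurable fun p : E × ℝ => F p.1 p.2)
    (h0 : ∀ x r, F x r ∈ Set.Icc (0 : ℝ) 1) (hmono : ∀ x, Monotone (F x))
    (hfix : ∀ x r, F x r = ∫ y, trunc F y (r - ξ y) ∂(P x)) :
    ∀ᵐ y ∂π, ξ y < 0 → F y 0 = 0 := by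
  obtain ⟨c, hc⟩ := iSup_eq_const_of_fixed hle hε0 hε1 hπ hξ hF h0 hmono hfix
  have hTI := trunc_mem_Icc h0
  have hTn : ∀ y r, ‖trunc F y r‖ ≤ 1 := fun y r => by
    rw [Real.norm_eq_abs, abs_of_nonneg (hTI y r).1]
    exact (hTI y r).2
  have hTi : ∀ y a b, IntervalIntegrable (trunc F y) volume a b := fun y a b =>
    (monotone_trunc h0 hmono y).intervalIntegrable
  have hT1 : Measurable fun p : E × ℝ => trunc F p.1 p.2 := measurable_trunc hF
  have hT2 : Measurable fun p : E × ℝ => trunc F p.1 (p.2 - ξ p.1) :=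
    hT1.comp (measurable_fst.prodMk (measurable_snd.sub (hξ.comp measurable_fst)))
  set D : ℕ → E → ℝ := fun n y =>
    ∫ r in (0 : ℝ)..n, (trunc F y r - trunc F y (r - ξ y)) with hD
  have hDm : ∀ n, StronglyMeasurable (D n) := fun n => by
    simp only [hD, intervalIntegral.integral_of_le (Nat.cast_nonneg n)]
    exact StronglyMeasurable.integral_prod_right' (ν := volume.restrict (Set.Ioc (0 : ℝ) n))
      (hT1.sub hT2).stronglyMeasurable
  have hD0 : ∀ n, ∫ y, D n y ∂π = 0 := fun n => by
    simp only [hD, intervalIntegral.integral_of_le (Nat.cast_nonneg n)]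
    rw [integral_integral_swap]
    · rw [setIntegral_eq_zero_of_forall_eq_zero]
      intro r hr
      rw [integral_sub, integral_trunc_eq_of_fixed hπ hξ hF h0 hfix hr.1.le, sub_self]
      · exact Doeblin.integrable_of_mem_Icc (hT1.comp (measurable_id.prodMk measurable_const))
          fun y => hTI _ _
      · exact Doeblin.integrable_of_mem_Icc (hT2.comp (measurable_id.prodMk measurable_const))
          fun y => hTI _ _
    · exact Doeblin.integrable_of_mem_Icc (a := -1) (b := 1) (hT1.sub hT2) fun p => by
        change trunc F p.1 p.2 - trunc F p.1 (p.2 - ξ p.1) ∈ _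
        exact ⟨by linarith [(hTI p.1 p.2).1, (hTI p.1 (p.2 - ξ p.1)).2],
          by linarith [(hTI p.1 p.2).2, (hTI p.1 (p.2 - ξ p.1)).1]⟩
  have hDeq : ∀ n y, D n y = (∫ r in (-ξ y)..0, trunc F y (r + n))
      + ∫ r in (0 : ℝ)..(-ξ y), trunc F y r := fun n y => by
    have hi : IntervalIntegrable (fun r => trunc F y (r - ξ y)) volume 0 n :=
      ((monotone_trunc h0 hmono y).comp fun a b h => sub_le_sub_right h (ξ y)).intervalIntegrable
    simp only [hD]
    rw [intervalIntegral.integral_sub (hTi y _ _) hi,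
      intervalIntegral.integral_comp_sub_right (trunc F y),
      intervalIntegral.integral_comp_add_right (trunc F y), zero_sub, zero_add,
      ← intervalIntegral.integral_add_adjacent_intervals (hTi y 0 (-ξ y)) (hTi y (-ξ y) n),
      ← intervalIntegral.integral_add_adjacent_intervals (hTi y (-ξ y) (n - ξ y)) (hTi y _ n)]
    rw [show (-ξ y + n : ℝ) = n - ξ y by ring]
    ring
  have hDlim : ∀ y, Tendsto (fun n => D n y) atTop
      (𝓝 (ξ y * c + ∫ r in (0 : ℝ)..(-ξ y), trunc F y r)) := fun y => by
    simp_rw [hDeq]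
    refine Tendsto.add_const _ ?_
    have h1 : ∫ _ in (-ξ y)..0, c = ξ y * c := by simp
    rw [← h1]
    refine intervalIntegral.tendsto_integral_filter_of_dominated_convergence (fun _ => 1)
      (Eventually.of_forall fun n => ?_) (Eventually.of_forall fun n => ae_of_all _ fun r _ => ?_)
      intervalIntegrable_const (ae_of_all _ fun r _ => ?_)
    · exact (hT1.comp (measurable_const.prodMk (measurable_id.add_const _))).aestronglyMeasurable
    · exact hTn _ _
    · rw [← hc y]
      exact (tendsto_trunc h0 hmono y).comp
        (tendsto_atTop_add_const_left _ r tendsto_natCast_atTop_atTop)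
  have hDb : ∀ n y, ‖D n y‖ ≤ 2 * |ξ y| := fun n y => by
    rw [hDeq, two_mul]
    refine (norm_add_le _ _).trans (add_le_add ?_ ?_)
    · simpa using intervalIntegral.norm_integral_le_of_norm_le_const
        (a := -ξ y) (b := 0) (f := fun r => trunc F y (r + n)) (C := 1) fun r _ => hTn _ _
    · simpa using intervalIntegral.norm_integral_le_of_norm_le_const
        (a := 0) (b := -ξ y) (f := trunc F y) (C := 1) fun r _ => hTn _ _
  set Φ : E → ℝ := fun y => ∫ r in (0 : ℝ)..(-ξ y), trunc F y r with hΦ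
  have hΦ0 : ∀ y, 0 ≤ Φ y := fun y => by
    rcases le_total 0 (-ξ y) with h | h
    · exact intervalIntegral.integral_nonneg h fun r _ => (hTI y r).1
    · refine le_of_eq (Eq.symm ?_)
      simp only [hΦ]
      rw [intervalIntegral.integral_of_ge h, neg_eq_zero, integral_Ioc_eq_integral_Ioo]
      refine setIntegral_eq_zero_of_forall_eq_zero fun r hr => ?_
      rw [trunc, if_neg (not_le.2 hr.2)]
  have hΦm : Measurable Φ := by
    have := (measurable_of_tendsto_metrizable (fun n => (hDm n).measurable)
      (tendsto_pi_nhds.2 hDlim)).sub (hξ.mul_const c)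
    convert this using 1
    exact funext fun y => by simp [hΦ]
  have hΦi : Integrable Φ π := by
    refine hξi.abs.mono' hΦm.aestronglyMeasurable (ae_of_all _ fun y => ?_)
    simpa using intervalIntegral.norm_integral_le_of_norm_le_const
        (a := 0) (b := -ξ y) (f := trunc F y) (C := 1) fun r _ => hTn _ _
  have hint : ∫ y, Φ y ∂π = 0 := by
    have hlim := tendsto_integral_of_dominated_convergence (μ := π) (fun y => 2 * |ξ y|)
      (fun n => (hDm n).aestronglyMeasurable) (hξi.abs.const_mul 2)
      (fun n => ae_of_all _ (hDb n)) (ae_of_all _ hDlim)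
    simp_rw [hD0] at hlim
    have := tendsto_nhds_unique hlim tendsto_const_nhds
    rwa [integral_add (hξi.mul_const c) hΦi, integral_mul_const, hξ0, zero_mul, zero_add] at this
  have hae := (integral_eq_zero_iff_of_nonneg hΦ0 hΦi).1 hint
  filter_upwards [hae] with y hy hneg
  have h1 : ∫ _ in (0 : ℝ)..(-ξ y), F y 0 ≤ Φ y := by
    refine intervalIntegral.integral_mono_on (by linarith) intervalIntegrable_const (hTi y _ _)
      fun r hr => ?_
    rw [trunc, if_pos hr.1]
    exact hmono y hr.1
  rw [hy, intervalIntegral.integral_const, sub_zero, smul_eq_mul, Pi.zero_apply] at h1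
  nlinarith [(h0 y 0).1]

/-- The survival equation of a mean zero Doeblin walk has no nonzero bounded monotone solution. -/
theorem eq_zero_of_fixed [IsMarkovKernel P] (hle : ∀ x, ε • ν ≤ P x) (hε0 : ε ≠ 0) (hε1 : ε ≤ 1)
    (hπ : π.bind P = π) (hνπ : ε • ν ≤ π) (hξ : Measurable ξ) (hξi : Integrable ξ π)
    (hξ0 : ∫ y, ξ y ∂π = 0)
    {δ : ℝ} (hδ : 0 < δ) (hνδ : ν {y | ξ y ≤ -δ} ≠ 0)
    (hF : Measurable fun p : E × ℝ => F p.1 p.2)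
    (h0 : ∀ x r, F x r ∈ Set.Icc (0 : ℝ) 1) (hmono : ∀ x, Monotone (F x))
    (hfix : ∀ x r, F x r = ∫ y, trunc F y (r - ξ y) ∂(P x)) (x : E) (r : ℝ) : F x r = 0 := by
  obtain ⟨c, hc⟩ := iSup_eq_const_of_fixed hle hε0 hε1 hπ hξ hF h0 hmono hfix
  have hac : ∀ m : Measure E, ε • ν ≤ m → ν ≪ m := fun m hm s hs => by
    have := le_antisymm ((hm s).trans hs.le) zero_le
    simpa [hε0] using this
  have hfreq : ∀ {p : E → Prop}, (∀ᵐ y ∂ν, p y) → ∃ y, ξ y ≤ -δ ∧ p y := fun {p} hp => by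
    by_contra! hcon
    exact hνδ (measure_mono_null (fun y hy => hcon y hy) hp)
  obtain ⟨y₀, hy₀, hy₀'⟩ := hfreq ((hac π hνπ).ae_le
    (ae_eq_zero_of_fixed hle hε0 hε1 hπ hξ hξi hξ0 hF h0 hmono hfix))
  have hstep : ∀ z t, 0 ≤ t → F z t = 0 → ∀ᵐ y ∂ν, ξ y ≤ -δ → F y (t + δ) = 0 :=
    fun z t ht hz => by
      have hT : Measurable fun y => trunc F y (t - ξ y) :=
        (measurable_trunc hF).comp (measurable_id.prodMk (hξ.const_sub _))
      have h1 := (integral_eq_zero_iff_of_nonneg (μ := P z)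
        (fun y => (trunc_mem_Icc h0 y (t - ξ y)).1)
        (Doeblin.integrable_of_mem_Icc hT fun y => trunc_mem_Icc h0 _ _)).1
        ((hfix z t).symm.trans hz)
      filter_upwards [(hac _ (hle z)).ae_le h1] with y hy hyδ
      rw [Pi.zero_apply, trunc, if_pos (by linarith)] at hy
      exact le_antisymm ((hmono y (by linarith)).trans_eq hy) (h0 y _).1
  have hall : ∀ n : ℕ, ∀ᵐ y ∂ν, ξ y ≤ -δ → F y (n * δ + δ) = 0 := fun n => by
    induction n with
    | zero => simpa using hstep y₀ 0 le_rfl (hy₀' (by linarith))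
    | succ n ih =>
      obtain ⟨z, hz, hz'⟩ := hfreq ih
      have := hstep z _ (by positivity) (hz' hz)
      push_cast
      simpa [add_mul] using this
  obtain ⟨z, hz, hz'⟩ := hfreq (ae_all_iff.2 hall)
  have hb : ∀ x, BddAbove (Set.range (F x)) := fun x =>
    ⟨1, by rintro _ ⟨r, rfl⟩; exact (h0 x r).2⟩
  have hc0 : c ≤ 0 := by
    rw [← hc z]
    refine ciSup_le fun t => ?_
    obtain ⟨n, hn⟩ := exists_nat_ge (t / δ)
    rw [div_le_iff₀ hδ] at hn
    exact (hmono z (by linarith)).trans_eq (hz' n hz)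
  exact le_antisymm ((le_ciSup (hb x) r).trans ((hc x).trans_le hc0)) (h0 x r).1

end Fixed

section Survival

variable {E : Type*} [MeasurableSpace E]

theorem trunc_le_trunc {E : Type*} {F G : E → ℝ → ℝ≥0∞} {y : E} {s t : ℝ} (hst : s ≤ t)
    (h : F y s ≤ G y t) : trunc F y s ≤ trunc G y t := by
  unfold trunc
  split_ifs with h1 h2
  · exact h
  · exact absurd (h1.trans hst) h2
  · exact zero_le
  · exact le_rfl

/-- The probability that the walk with increments `ξ` along the chain `P` started at `p.1` does
not exceed `p.2` up to time `n`. -/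
def surv (P : Kernel E E) (ξ : E → ℝ) : ℕ → E → ℝ → ℝ≥0∞
  | 0 => fun _ _ => 1
  | n + 1 => fun x r => ∫⁻ y, trunc (surv P ξ n) y (r - ξ y) ∂(P x)

variable {P : Kernel E E} {ξ : E → ℝ}

theorem surv_mono (n : ℕ) (x : E) : Monotone (surv P ξ n x) := by
  induction n generalizing x with
  | zero => exact monotone_const
  | succ n ih =>
    exact fun r r' h => lintegral_mono fun y =>
      trunc_le_trunc (sub_le_sub_right h _) (ih y (sub_le_sub_right h _))

theorem surv_succ_le [IsMarkovKernel P] (n : ℕ) (x : E) (r : ℝ) :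
    surv P ξ (n + 1) x r ≤ surv P ξ n x r := by
  induction n generalizing x r with
  | zero =>
    calc surv P ξ 1 x r ≤ ∫⁻ _, 1 ∂(P x) := lintegral_mono fun y => by
          unfold trunc
          split_ifs <;> simp [surv]
      _ = 1 := by simp
  | succ n ih => exact lintegral_mono fun y => trunc_le_trunc le_rfl (ih y _)

theorem surv_antitone [IsMarkovKernel P] (x : E) (r : ℝ) : Antitone fun n => surv P ξ n x r :=
  antitone_nat_of_succ_le fun n => surv_succ_le n x r

theorem measurable_surv [IsMarkovKernel P] (hξ : Measurable ξ) (n : ℕ) :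
    Measurable fun p : E × ℝ => surv P ξ n p.1 p.2 := by
  induction n with
  | zero => exact measurable_const
  | succ n ih =>
    refine Measurable.lintegral_kernel_prod_right' (κ := P.comap Prod.fst measurable_fst)
      (f := fun q : (E × ℝ) × E => trunc (surv P ξ n) q.2 (q.1.2 - ξ q.2)) ?_
    exact (measurable_trunc ih).comp (measurable_snd.prodMk
      ((measurable_snd.comp measurable_fst).sub (hξ.comp measurable_snd)))

theorem iInf_surv_eq [IsMarkovKernel P] (hξ : Measurable ξ) (x : E) (r : ℝ) :
    ⨅ n, surv P ξ n x r = ∫⁻ y, trunc (fun y t => ⨅ n, surv P ξ n y t) y (r - ξ y) ∂(P x) := by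
  have h1 : ∀ y t, trunc (fun y t => ⨅ n, surv P ξ n y t) y t
      = ⨅ n, trunc (surv P ξ n) y t := fun y t => by
    unfold trunc
    split_ifs
    · rfl
    · simp
  simp_rw [h1]
  rw [lintegral_iInf]
  · refine le_antisymm (le_iInf fun n => iInf_le _ (n + 1)) (le_iInf fun n => ?_)
    exact (iInf_le _ n).trans (surv_succ_le n x r)
  · exact fun n => (measurable_trunc (measurable_surv hξ n)).comp
      (measurable_id.prodMk (hξ.const_sub _))
  · exact fun n m h y => trunc_le_trunc le_rfl (surv_antitone _ _ h)
  · have : ∫⁻ y, trunc (surv P ξ 0) y (r - ξ y) ∂(P x) = surv P ξ 1 x r := rfl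
    rw [this]
    exact ne_top_of_le_ne_top ENNReal.one_ne_top (surv_succ_le 0 x r)

/-- A mean zero walk along a Doeblin chain exceeds every level almost surely. -/
theorem iInf_surv_eq_zero [IsMarkovKernel P] {ν π : Measure E} [IsProbabilityMeasure ν]
    [IsProbabilityMeasure π] {ε : ℝ≥0∞} (hle : ∀ x, ε • ν ≤ P x) (hε0 : ε ≠ 0) (hε1 : ε ≤ 1)
    (hπ : π.bind P = π) (hνπ : ε • ν ≤ π) (hξ : Measurable ξ) (hξi : Integrable ξ π)
    (hξ0 : ∫ y, ξ y ∂π = 0) {δ : ℝ} (hδ : 0 < δ) (hνδ : ν {y | ξ y ≤ -δ} ≠ 0) (x : E) (r : ℝ) :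
    ⨅ n, surv P ξ n x r = 0 := by
  have hle1 : ∀ x r, ⨅ n, surv P ξ n x r ≤ 1 := fun x r => iInf_le _ 0
  have hne : ∀ x r, ⨅ n, surv P ξ n x r ≠ ∞ := fun x r =>
    ne_top_of_le_ne_top ENNReal.one_ne_top (hle1 x r)
  have hm : Measurable fun p : E × ℝ => ⨅ n, surv P ξ n p.1 p.2 :=
    Measurable.iInf fun n => measurable_surv hξ n
  have := eq_zero_of_fixed (F := fun x r => (⨅ n, surv P ξ n x r).toReal) hle hε0 hε1 hπ hνπ hξ
    hξi hξ0 hδ hνδ hm.ennreal_toReal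
    (fun x r => ⟨ENNReal.toReal_nonneg,
      by simpa using ENNReal.toReal_mono ENNReal.one_ne_top (hle1 x r)⟩)
    (fun x r r' h => ENNReal.toReal_mono (hne x r') (iInf_mono fun n => surv_mono n x h))
    (fun x r => ?_) x r
  · exact ((ENNReal.toReal_eq_zero_iff _).1 this).resolve_right (hne x r)
  · rw [iInf_surv_eq hξ, ← integral_toReal]
    · refine integral_congr_ae (ae_of_all _ fun y => ?_)
      simp only [trunc]
      split_ifs <;> simp
    · exact ((measurable_trunc (F := fun x r => ⨅ n, surv P ξ n x r) hm).comp
        (measurable_id.prodMk (hξ.const_sub _))).aemeasurable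
    · refine ae_of_all _ fun y => lt_top_iff_ne_top.2 ?_
      unfold trunc
      split_ifs
      · exact hne _ _
      · simp

end Survival

section FirstHit

/-- `min {k > t : p k}`, equal to `⊤` if there is no such `k`. -/
def firstHit (p : ℕ → Prop) (t : ℕ∞) : ℕ∞ := ⨅ (k : ℕ) (_ : t < (k : ℕ∞) ∧ p k), (k : ℕ∞)

theorem firstHit_eq_coe_iff {p : ℕ → Prop} {t : ℕ∞} {n : ℕ} :
    firstHit p t = n ↔ t < n ∧ p n ∧ ∀ j : ℕ, t < j → j < n → ¬ p j := by
  classical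
  by_cases h : ∃ k : ℕ, t < (k : ℕ∞) ∧ p k
  · have hfind : firstHit p t = (Nat.find h : ℕ) := by
      refine le_antisymm (iInf₂_le (Nat.find h) (Nat.find_spec h)) ?_
      exact le_iInf₂ fun k hk => by exact_mod_cast Nat.find_min' h hk
    rw [hfind, Nat.cast_inj, Nat.find_eq_iff]
    constructor
    · rintro ⟨⟨h1, h2⟩, h3⟩
      exact ⟨h1, h2, fun j hj hjn hpj => h3 j hjn ⟨hj, hpj⟩⟩
    · rintro ⟨h1, h2, h3⟩
      exact ⟨⟨h1, h2⟩, fun j hjn hj => h3 j hj.1 hjn hj.2⟩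
  · have htop : firstHit p t = ⊤ := by
      simp only [firstHit, iInf_eq_top]
      exact fun k hk => absurd ⟨k, hk⟩ h
    rw [htop]
    constructor
    · exact fun h' => absurd h'.symm (ENat.natCast_ne_top n)
    · exact fun h' => absurd ⟨n, h'.1, h'.2.1⟩ h

theorem exists_of_firstHit_ne_top {p : ℕ → Prop} {t : ℕ∞} (h : firstHit p t ≠ ⊤) :
    ∃ m k : ℕ, t = m ∧ firstHit p t = (m + 1 + k : ℕ) := by
  obtain ⟨n, hn⟩ := ENat.ne_top_iff_exists.1 h
  have hlt := (firstHit_eq_coe_iff.1 hn.symm).1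
  obtain ⟨m, rfl⟩ := ENat.ne_top_iff_exists.1 (ne_top_of_lt hlt)
  have hmn : m + 1 ≤ n := by exact_mod_cast hlt
  obtain ⟨k, rfl⟩ := Nat.exists_eq_add_of_le hmn
  exact ⟨m, k, rfl, hn.symm⟩

theorem firstHit_coe_eq_iff {p : ℕ → Prop} {t k : ℕ} :
    firstHit p t = (t + 1 + k : ℕ) ↔ p (t + 1 + k) ∧ ∀ j < k, ¬ p (t + 1 + j) := by
  rw [firstHit_eq_coe_iff]
  constructor
  · rintro ⟨-, h2, h3⟩
    exact ⟨h2, fun j hj => h3 _ (by exact_mod_cast (by lia : t < t + 1 + j)) (by lia)⟩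
  · rintro ⟨h1, h2⟩
    refine ⟨by exact_mod_cast (by lia : t < t + 1 + k), h1, fun j hj hjk => ?_⟩
    have hj' : t + 1 ≤ j := by exact_mod_cast hj
    obtain ⟨i, rfl⟩ := Nat.exists_eq_add_of_le hj'
    exact h2 i (by lia)

end FirstHit

section HittingKernel

variable {Z : Type*} [MeasurableSpace Z] (K : Kernel Z Z) {D : Set Z} (hD : MeasurableSet D)

/-- The law of the chain at time `k + 1`, on the event that this is the first entrance to `D`. -/
def hitStep : ℕ → Kernel Z Z
  | 0 => K.restrict hD
  | k + 1 => hitStep k ∘ₖ K.restrict hD.compl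

/-- The probability that the chain avoids `D` at the times `1, …, n`. -/
def avoid (K : Kernel Z Z) (D : Set Z) : ℕ → Z → ℝ≥0∞
  | 0 => fun _ => 1
  | n + 1 => fun z => ∫⁻ z' in Dᶜ, avoid K D n z' ∂(K z)

/-- The law of the position and of the time of the first entrance to `D`. -/
def hit : Kernel Z (Z × ℕ) := Kernel.sum fun k => (hitStep K hD k).map fun z => (z, k + 1)

variable {K hD}

theorem lintegral_hitStep_succ (k : ℕ) (z : Z) {f : Z → ℝ≥0∞} (hf : Measurable f) :
    ∫⁻ y, f y ∂(hitStep K hD (k + 1) z)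
      = ∫⁻ z' in Dᶜ, ∫⁻ y, f y ∂(hitStep K hD k z') ∂(K z) := by
  rw [hitStep, Kernel.lintegral_comp _ _ _ hf, Kernel.restrict_apply]

theorem hitStep_succ_apply (k : ℕ) (z : Z) {B : Set Z} (hB : MeasurableSet B) :
    hitStep K hD (k + 1) z B = ∫⁻ z' in Dᶜ, hitStep K hD k z' B ∂(K z) := by
  rw [hitStep, Kernel.comp_apply' _ _ _ hB, Kernel.restrict_apply]

theorem sum_hitStep_add_avoid [IsMarkovKernel K] (n : ℕ) (z : Z) :
    ∑ k ∈ Finset.range n, hitStep K hD k z Set.univ + avoid K D n z = 1 := by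
  induction n generalizing z with
  | zero => simp [avoid]
  | succ n ih =>
    rw [Finset.sum_range_succ', avoid]
    simp_rw [hitStep_succ_apply _ z MeasurableSet.univ]
    rw [← lintegral_finsetSum _ fun k _ => Kernel.measurable_coe _ MeasurableSet.univ,
      add_right_comm, ← lintegral_add_left
        (Finset.measurable_fun_sum _ fun k _ => Kernel.measurable_coe _ MeasurableSet.univ)]
    simp_rw [ih]
    rw [lintegral_one, hitStep, Kernel.restrict_apply, Measure.restrict_apply MeasurableSet.univ,
      Measure.restrict_apply MeasurableSet.univ, Set.univ_inter, Set.univ_inter,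
      add_comm, measure_add_measure_compl hD, measure_univ]

theorem hit_apply (z : Z) {B : Set (Z × ℕ)} (hB : MeasurableSet B) :
    hit K hD z B = ∑' k, hitStep K hD k z ((fun y => (y, k + 1)) ⁻¹' B) := by
  rw [hit, Kernel.sum_apply' _ _ hB]
  refine tsum_congr fun k => ?_
  have hm : Measurable fun y : Z => (y, k + 1) := measurable_id.prodMk measurable_const
  rw [Kernel.map_apply' _ hm _ hB]

theorem lintegral_hit (z : Z) {f : Z × ℕ → ℝ≥0∞} (hf : Measurable f) :
    ∫⁻ p, f p ∂(hit K hD z) = ∑' k, ∫⁻ y, f (y, k + 1) ∂(hitStep K hD k z) := by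
  rw [hit, Kernel.sum_apply, lintegral_sum_measure]
  refine tsum_congr fun k => ?_
  have hm : Measurable fun y : Z => (y, k + 1) := measurable_id.prodMk measurable_const
  rw [Kernel.map_apply _ hm, lintegral_map hf hm]

theorem isMarkovKernel_hit [IsMarkovKernel K] (h : ∀ z, ⨅ n, avoid K D n z = 0) :
    IsMarkovKernel (hit K hD) := by
  refine ⟨fun z => ⟨?_⟩⟩
  rw [hit_apply z MeasurableSet.univ]
  simp only [Set.preimage_univ]
  refine le_antisymm ?_ ?_
  · rw [ENNReal.tsum_eq_iSup_nat]
    exact iSup_le fun n => le_self_add.trans (sum_hitStep_add_avoid (hD := hD) n z).le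
  · refine ENNReal.le_of_forall_pos_le_add fun e he _ => ?_
    obtain ⟨n, hn⟩ := iInf_lt_iff.1 ((h z).trans_lt (ENNReal.coe_pos.2 he))
    rw [← sum_hitStep_add_avoid (K := K) (hD := hD) n z]
    exact add_le_add (ENNReal.sum_le_tsum _) hn.le

/-- Decomposition of the entrance law according to the first step. -/
theorem le_lintegral_hit (z : Z) {f : Z → ℝ≥0∞} (hf : Measurable f) :
    ∫⁻ z' in Dᶜ, ∫⁻ p, f p.1 ∂(hit K hD z') ∂(K z) ≤ ∫⁻ p, f p.1 ∂(hit K hD z) := by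
  have hf' : Measurable fun p : Z × ℕ => f p.1 := hf.comp measurable_fst
  simp_rw [lintegral_hit _ hf']
  rw [lintegral_tsum fun k => hf.lintegral_kernel.aemeasurable, tsum_eq_zero_add'
    (f := fun k => ∫⁻ y, f y ∂(hitStep K hD k z)) ENNReal.summable]
  simp_rw [lintegral_hitStep_succ _ z hf]
  exact le_add_self

/-- A property that holds at the first entrance to `D` by any single step from outside `D`. -/
theorem hit_eq_zero_of_step {N : Set Z} (hN : MeasurableSet N)
    (h : ∀ z ∉ D, K z (N ∩ D) = 0) {z : Z} (hz : z ∉ D) :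
    hit K hD z (N ×ˢ Set.univ ∪ Set.univ ×ˢ {0}) = 0 := by
  have key : ∀ k, ∀ z ∉ D, hitStep K hD k z N = 0 := fun k => by
    induction k with
    | zero =>
      intro z hz
      rw [hitStep, Kernel.restrict_apply, Measure.restrict_apply hN]
      exact h z hz
    | succ k ih =>
      intro z _
      rw [hitStep_succ_apply _ _ hN]
      exact setLIntegral_eq_zero hD.compl fun z' hz' => ih z' hz'
  rw [hit_apply _ ((hN.prod MeasurableSet.univ).union
    (MeasurableSet.univ.prod (measurableSet_singleton _))), ENNReal.tsum_eq_zero]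
  intro k
  rw [← key k z hz]
  congr 1
  ext y
  simp

end HittingKernel

section Stopping

variable {Ω Z : Type*} {mΩ : MeasurableSpace Ω}

/-- The events that precede the time `T`. -/
@[reducible] def pastOf (𝓕 : ℕ → MeasurableSpace Ω) (T : Ω → ℕ∞)
    (hT : ∀ t : ℕ, MeasurableSet[𝓕 t] {ω | T ω = t}) : MeasurableSpace Ω where
  MeasurableSet' A := ∀ t : ℕ, MeasurableSet[𝓕 t] (A ∩ {ω | T ω = t})
  measurableSet_empty t := by simp
  measurableSet_compl A hA t := by
    have : Aᶜ ∩ {ω | T ω = t} = {ω | T ω = t} \ (A ∩ {ω | T ω = t}) := by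
      ext ω
      simp only [Set.mem_inter_iff, Set.mem_compl_iff, Set.mem_sdiff]
      tauto
    rw [this]
    exact (hT t).diff (hA t)
  measurableSet_iUnion A hA t := by
    rw [Set.iUnion_inter]
    exact MeasurableSet.iUnion fun i => hA i t

variable {𝓕 : ℕ → MeasurableSpace Ω} {T : Ω → ℕ∞}

theorem measurableSet_inter_firstHit (hmono : Monotone 𝓕) {p : ℕ → Ω → Prop}
    (hp : ∀ n, MeasurableSet[𝓕 n] {ω | p n ω}) {A : Set Ω}
    (hA : ∀ t : ℕ, MeasurableSet[𝓕 t] (A ∩ {ω | T ω = t})) (n : ℕ) :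
    MeasurableSet[𝓕 n] (A ∩ {ω | firstHit (fun k => p k ω) (T ω) = n}) := by
  have : A ∩ {ω | firstHit (fun k => p k ω) (T ω) = n}
      = ⋃ t : ℕ, ⋃ _ : t < n, (A ∩ {ω | T ω = t}) ∩ ({ω | p n ω}
        ∩ ⋂ j : ℕ, ⋂ _ : t < j ∧ j < n, {ω | p j ω}ᶜ) := by
    ext ω
    simp only [Set.mem_inter_iff, Set.mem_ofPred_eq, Set.mem_iUnion, Set.mem_iInter,
      Set.mem_compl_iff, firstHit_eq_coe_iff]
    constructor
    · rintro ⟨h1, h2, h3, h4⟩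
      obtain ⟨t, ht⟩ := ENat.ne_top_iff_exists.1 (ne_top_of_lt h2)
      rw [← ht] at h2 h4
      exact ⟨t, by exact_mod_cast h2, ⟨h1, ht.symm⟩, h3,
        fun j hj => h4 j (by exact_mod_cast hj.1) hj.2⟩
    · rintro ⟨t, ht, ⟨h1, h2⟩, h3, h4⟩
      rw [h2]
      exact ⟨h1, by exact_mod_cast ht, h3, fun j hj hjn => h4 j ⟨by exact_mod_cast hj, hjn⟩⟩
  rw [this]
  refine MeasurableSet.iUnion fun t => MeasurableSet.iUnion fun ht => ?_
  refine (hmono ht.le _ (hA t)).inter ((hp n).inter ?_)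
  exact MeasurableSet.iInter fun j => MeasurableSet.iInter fun hj =>
    (hmono hj.2.le _ (hp j)).compl

theorem measurableSet_firstHit (hmono : Monotone 𝓕) {p : ℕ → Ω → Prop}
    (hp : ∀ n, MeasurableSet[𝓕 n] {ω | p n ω})
    (hT : ∀ t : ℕ, MeasurableSet[𝓕 t] {ω | T ω = t}) (n : ℕ) :
    MeasurableSet[𝓕 n] {ω | firstHit (fun k => p k ω) (T ω) = n} := by
  simpa using measurableSet_inter_firstHit (A := Set.univ) hmono hp (by simpa using hT) n

/-- The value of a process at an extended time. -/
def atTime (Y : ℕ → Ω → Z) (T : Ω → ℕ∞) (ω : Ω) : Z := Y (T ω).toNat ω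

theorem measurable_toNat_of_measurableSet (hT : ∀ t : ℕ, MeasurableSet {ω | T ω = t}) :
    Measurable fun ω => (T ω).toNat := by
  refine measurable_to_countable' fun t => ?_
  have : (fun ω => (T ω).toNat) ⁻¹' {t}
      = {ω | T ω = t} ∪ ({_ω | t = 0} ∩ (⋃ s : ℕ, {ω | T ω = s})ᶜ) := by
    ext ω
    simp only [Set.mem_preimage, Set.mem_singleton_iff, Set.mem_union, Set.mem_ofPred_eq,
      Set.mem_inter_iff, Set.mem_compl_iff, Set.mem_iUnion, not_exists]
    cases h : T ω with
    | top =>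
      simp [eq_comm]
    | coe n =>
      simp
  rw [this]
  exact (hT t).union ((MeasurableSet.const _).inter (MeasurableSet.iUnion hT).compl)

variable [MeasurableSpace Z] {Y : ℕ → Ω → Z}

theorem measurable_atTime (hY : ∀ n, Measurable (Y n))
    (hT : ∀ t : ℕ, MeasurableSet {ω | T ω = t}) : Measurable (atTime Y T) := by
  have h1 : Measurable fun q : ℕ × Ω => Y q.1 q.2 := measurable_from_prod_countable_right hY
  exact h1.comp ((measurable_toNat_of_measurableSet hT).prodMk measurable_id)

theorem measurable_pastOf_toNat (hT : ∀ t : ℕ, MeasurableSet[𝓕 t] {ω | T ω = t}) :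
    Measurable[pastOf 𝓕 T hT] fun ω => (T ω).toNat := by
  intro s _ t
  by_cases h : t ∈ s
  · convert hT t using 1
    ext ω
    simp only [Set.mem_inter_iff, Set.mem_preimage, Set.mem_ofPred_eq, and_iff_right_iff_imp]
    intro hω
    simpa [hω] using h
  · convert MeasurableSet.empty using 1
    ext ω
    simp only [Set.mem_inter_iff, Set.mem_preimage, Set.mem_ofPred_eq, Set.mem_empty_iff_false,
      iff_false, not_and]
    intro h1 hω
    rw [hω] at h1
    exact h h1

theorem measurable_pastOf_atTime (hY : ∀ n, Measurable[𝓕 n] (Y n))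
    (hT : ∀ t : ℕ, MeasurableSet[𝓕 t] {ω | T ω = t}) :
    Measurable[pastOf 𝓕 T hT] (atTime Y T) := by
  intro C hC t
  have : atTime Y T ⁻¹' C ∩ {ω | T ω = t} = Y t ⁻¹' C ∩ {ω | T ω = t} := by
    ext ω
    simp only [Set.mem_inter_iff, Set.mem_preimage, Set.mem_ofPred_eq, atTime]
    constructor <;> rintro ⟨h1, h2⟩ <;> refine ⟨?_, h2⟩ <;> simpa [h2] using h1
  rw [this]
  exact (hY t hC).inter (hT t)

end Stopping

section StrongMarkov

variable {Ω Z : Type*} {mΩ : MeasurableSpace Ω} [MeasurableSpace Z]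

/-- `Y` is adapted to `𝓕` and has transition kernel `K` with respect to `𝓕`. -/
structure IsAdaptedMarkov (μ : Measure Ω) (𝓕 : ℕ → MeasurableSpace Ω) (Y : ℕ → Ω → Z)
    (K : Kernel Z Z) : Prop where
  le : ∀ n, 𝓕 n ≤ mΩ
  mono : Monotone 𝓕
  adapted : ∀ n, Measurable[𝓕 n] (Y n)
  step : ∀ (n : ℕ) (A : Set Ω), MeasurableSet[𝓕 n] A → ∀ B : Set Z, MeasurableSet B →
    μ (A ∩ Y (n + 1) ⁻¹' B) = ∫⁻ ω in A, K (Y n ω) B ∂μ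

variable {μ : Measure Ω} {𝓕 : ℕ → MeasurableSpace Ω} {Y : ℕ → Ω → Z} {K : Kernel Z Z} {D : Set Z}

theorem IsAdaptedMarkov.measurable (h : IsAdaptedMarkov μ 𝓕 Y K) (n : ℕ) : Measurable (Y n) :=
  (h.adapted n).mono (h.le n) le_rfl

theorem IsAdaptedMarkov.lintegral_step (h : IsAdaptedMarkov μ 𝓕 Y K) (n : ℕ) {A : Set Ω}
    (hA : MeasurableSet[𝓕 n] A) {f : Z → ℝ≥0∞} (hf : Measurable f) :
    ∫⁻ ω in A, f (Y (n + 1) ω) ∂μ = ∫⁻ ω in A, ∫⁻ z, f z ∂(K (Y n ω)) ∂μ := by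
  have hm : (μ.restrict A).map (Y (n + 1)) = ((μ.restrict A).map (Y n)).bind K := by
    ext B hB
    rw [Measure.map_apply (h.measurable _) hB, Measure.bind_apply hB (Kernel.aemeasurable _),
      lintegral_map (K.measurable_coe hB) (h.measurable n),
      Measure.restrict_apply (h.measurable _ hB), Set.inter_comm, h.step n A hA B hB]
  rw [← lintegral_map hf (h.measurable _), hm, Measure.lintegral_bind (Kernel.aemeasurable _)
    hf.aemeasurable, lintegral_map hf.lintegral_kernel (h.measurable n)]

theorem IsAdaptedMarkov.measure_firstHit (h : IsAdaptedMarkov μ 𝓕 Y K) (hD : MeasurableSet D)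
    (k t : ℕ) {A : Set Ω} (hA : MeasurableSet[𝓕 t] A) {B : Set Z} (hB : MeasurableSet B) :
    μ (A ∩ {ω | firstHit (fun n => Y n ω ∈ D) t = (t + 1 + k : ℕ) ∧ Y (t + 1 + k) ω ∈ B})
      = ∫⁻ ω in A, hitStep K hD k (Y t ω) B ∂μ := by
  simp only [firstHit_coe_eq_iff]
  induction k generalizing t A with
  | zero =>
    simp only [hitStep, Kernel.restrict_apply, Measure.restrict_apply hB]
    rw [← h.step t A hA _ (hB.inter hD)]
    congr 1
    ext ω
    simp [and_comm]
  | succ k ih =>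
    have hDc : MeasurableSet[𝓕 (t + 1)] (Y (t + 1) ⁻¹' Dᶜ) := h.adapted (t + 1) hD.compl
    rw [show t + 1 + (k + 1) = t + 1 + 1 + k by lia]
    have hset : A ∩ {ω | (Y (t + 1 + 1 + k) ω ∈ D ∧ ∀ j < k + 1, Y (t + 1 + j) ω ∉ D)
          ∧ Y (t + 1 + 1 + k) ω ∈ B}
        = (A ∩ Y (t + 1) ⁻¹' Dᶜ) ∩ {ω | (Y (t + 1 + 1 + k) ω ∈ D
          ∧ ∀ j < k, Y (t + 1 + 1 + j) ω ∉ D) ∧ Y (t + 1 + 1 + k) ω ∈ B} := by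
      ext ω
      have hall : (∀ j < k + 1, Y (t + 1 + j) ω ∉ D)
          ↔ Y (t + 1) ω ∉ D ∧ ∀ j < k, Y (t + 1 + 1 + j) ω ∉ D := by
        rw [Nat.forall_lt_succ_left']
        refine and_congr Iff.rfl (forall₂_congr fun j _ => ?_)
        rw [show t + 1 + (j + 1) = t + 1 + 1 + j by lia]
      simp only [Set.mem_inter_iff, Set.mem_ofPred_eq, Set.mem_preimage, Set.mem_compl_iff,
        hall]
      tauto
    rw [hset, ih (t + 1) ((h.mono t.le_succ _ hA).inter hDc), Set.inter_comm,
      ← Measure.restrict_restrict (h.le _ _ hDc)]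
    have hf : Measurable fun z => hitStep K hD k z B := Kernel.measurable_coe _ hB
    rw [← lintegral_indicator (h.le _ _ hDc)]
    have h2 := h.lintegral_step t hA (hf.indicator hD.compl)
    refine Eq.trans ?_ (h2.trans ?_)
    · rfl
    · refine lintegral_congr fun ω => ?_
      rw [lintegral_indicator hD.compl, hitStep_succ_apply _ _ hB]

variable {T : Ω → ℕ∞}

theorem IsAdaptedMarkov.measure_hit_ne_top (h : IsAdaptedMarkov μ 𝓕 Y K) (hD : MeasurableSet D)
    (hT : ∀ t : ℕ, MeasurableSet[𝓕 t] {ω | T ω = t}) (hfin : ∀ᵐ ω ∂μ, T ω ≠ ⊤) {A : Set Ω}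
    (hA : MeasurableSet[pastOf 𝓕 T hT] A) {B : Set (Z × ℕ)} (hB : MeasurableSet B) :
    μ (A ∩ {ω | firstHit (fun n => Y n ω ∈ D) (T ω) ≠ ⊤ ∧
        (atTime Y (fun ω => firstHit (fun n => Y n ω ∈ D) (T ω)) ω,
          (firstHit (fun n => Y n ω ∈ D) (T ω)).toNat - (T ω).toNat) ∈ B})
      = ∫⁻ ω in A, hit K hD (atTime Y T ω) B ∂μ := by
  have hBk : ∀ k : ℕ, MeasurableSet ((fun z : Z => (z, k + 1)) ⁻¹' B) := fun k =>
    (measurable_id.prodMk measurable_const) hB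
  have hp : ∀ n, MeasurableSet[𝓕 n] {ω | Y n ω ∈ D} := fun n => h.adapted n hD
  have hAt : ∀ t : ℕ, MeasurableSet (A ∩ {ω | T ω = t}) := fun t => h.le t _ (hA t)
  have hdisj : Pairwise (Function.onFun Disjoint fun t : ℕ => A ∩ {ω | T ω = t}) :=
    fun s t hst => Set.disjoint_left.2 fun ω h1 h2 => hst (by
      have := h1.2.symm.trans h2.2
      exact_mod_cast this)
  set W : ℕ → ℕ → Set Ω := fun t k => (A ∩ {ω | T ω = t}) ∩
    {ω | firstHit (fun n => Y n ω ∈ D) t = (t + 1 + k : ℕ) ∧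
      Y (t + 1 + k) ω ∈ (fun z : Z => (z, k + 1)) ⁻¹' B} with hW
  have hWm : ∀ t k, MeasurableSet (W t k) := fun t k => by
    refine (hAt t).inter (MeasurableSet.inter ?_ (h.measurable _ (hBk k)))
    have := measurableSet_firstHit (T := fun _ : Ω => (t : ℕ∞)) h.mono hp
      (fun s => MeasurableSet.const _) (t + 1 + k)
    exact h.le _ _ this
  have hset : A ∩ {ω | firstHit (fun n => Y n ω ∈ D) (T ω) ≠ ⊤ ∧
        (atTime Y (fun ω => firstHit (fun n => Y n ω ∈ D) (T ω)) ω,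
          (firstHit (fun n => Y n ω ∈ D) (T ω)).toNat - (T ω).toNat) ∈ B}
      = ⋃ t, ⋃ k, W t k := by
    ext ω
    simp only [Set.mem_inter_iff, Set.mem_ofPred_eq, Set.mem_iUnion, hW, Set.mem_preimage, atTime]
    have hsub : ∀ m k : ℕ, m + 1 + k - m = k + 1 := fun m k => by lia
    constructor
    · rintro ⟨h1, h2, h3⟩
      obtain ⟨m, k, hm, hk⟩ := exists_of_firstHit_ne_top h2
      rw [hk, hm, ENat.toNat_natCast, ENat.toNat_natCast, hsub] at h3
      exact ⟨m, k, ⟨h1, hm⟩, hm ▸ hk, h3⟩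
    · rintro ⟨m, k, ⟨h1, hm⟩, hk, h3⟩
      rw [hm, hk, ENat.toNat_natCast, ENat.toNat_natCast, hsub]
      exact ⟨h1, ENat.natCast_ne_top _, h3⟩
  have hAe : A =ᵐ[μ] ⋃ t : ℕ, A ∩ {ω | T ω = t} := by
    refine eventuallyEq_set.2 ?_
    filter_upwards [hfin] with ω hω
    obtain ⟨t, ht⟩ := ENat.ne_top_iff_exists.1 hω
    simp only [Set.mem_iUnion, Set.mem_inter_iff, Set.mem_ofPred_eq]
    exact ⟨fun h1 => ⟨t, h1, ht.symm⟩, fun ⟨_, h1, _⟩ => h1⟩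
  rw [hset, Measure.restrict_congr_set hAe, lintegral_iUnion hAt hdisj, measure_iUnion]
  · refine tsum_congr fun t => ?_
    rw [measure_iUnion _ (hWm t)]
    · simp_rw [hW, h.measure_firstHit hD _ t (hA t) (hBk _)]
      have hm : ∀ k, Measurable fun ω => hitStep K hD k (Y t ω) ((fun z => (z, k + 1)) ⁻¹' B) :=
        fun k => (Kernel.measurable_coe _ (hBk k)).comp (h.measurable t)
      rw [← lintegral_tsum fun k => (hm k).aemeasurable]
      refine setLIntegral_congr_fun (hAt t) fun ω hω => ?_
      rw [hit_apply _ hB, atTime, show T ω = t from hω.2, ENat.toNat_natCast]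
    · intro k l hkl
      refine Set.disjoint_left.2 fun ω h1 h2 => hkl ?_
      have := h1.2.1.symm.trans h2.2.1
      have : t + 1 + k = t + 1 + l := by exact_mod_cast this
      lia
  · intro s t hst
    refine (hdisj hst).mono ?_ ?_ <;>
    exact Set.iUnion_subset fun k => Set.inter_subset_left
  · exact fun t => MeasurableSet.iUnion (hWm t)

theorem IsAdaptedMarkov.ae_firstHit_ne_top [IsProbabilityMeasure μ]
    (h : IsAdaptedMarkov μ 𝓕 Y K) (hD : MeasurableSet D) [IsMarkovKernel (hit K hD)]
    (hT : ∀ t : ℕ, MeasurableSet[𝓕 t] {ω | T ω = t}) (hfin : ∀ᵐ ω ∂μ, T ω ≠ ⊤) :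
    ∀ᵐ ω ∂μ, firstHit (fun n => Y n ω ∈ D) (T ω) ≠ ⊤ := by
  have := h.measure_hit_ne_top hD hT hfin (A := Set.univ) MeasurableSet.univ
    (B := Set.univ) MeasurableSet.univ
  simp only [Set.univ_inter, Set.mem_univ, and_true, measure_univ, Measure.restrict_univ,
    lintegral_one] at this
  refine (prob_compl_eq_zero_iff₀ ?_).2 this
  refine NullMeasurableSet.compl (s := {ω | firstHit (fun n => Y n ω ∈ D) (T ω) = ⊤}) ?_
  have hs : {ω | firstHit (fun n => Y n ω ∈ D) (T ω) = ⊤}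
      = (⋃ n : ℕ, {ω | firstHit (fun n => Y n ω ∈ D) (T ω) = n})ᶜ := by
    ext ω
    simp only [Set.mem_ofPred_eq, Set.mem_compl_iff, Set.mem_iUnion]
    rw [← not_iff_not, not_not, ← ne_eq, ENat.ne_top_iff_exists]
    exact exists_congr fun _ => eq_comm
  rw [hs]
  exact (MeasurableSet.iUnion fun n => h.le n _ (measurableSet_firstHit h.mono
    (fun n => h.adapted n hD) hT n)).compl.nullMeasurableSet

/-- The strong Markov property: the joint law of the state at `T` and the entrance after `T`. -/
theorem IsAdaptedMarkov.map_firstHit [IsProbabilityMeasure μ] (h : IsAdaptedMarkov μ 𝓕 Y K)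
    (hD : MeasurableSet D) [IsMarkovKernel (hit K hD)]
    (hT : ∀ t : ℕ, MeasurableSet[𝓕 t] {ω | T ω = t}) (hfin : ∀ᵐ ω ∂μ, T ω ≠ ⊤) {A : Set Ω}
    (hA : MeasurableSet[pastOf 𝓕 T hT] A) :
    (μ.restrict A).map (fun ω => (atTime Y T ω,
        (atTime Y (fun ω => firstHit (fun n => Y n ω ∈ D) (T ω)) ω,
          (firstHit (fun n => Y n ω ∈ D) (T ω)).toNat - (T ω).toNat)))
      = ((μ.restrict A).map (atTime Y T)) ⊗ₘ hit K hD := by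
  have hp : ∀ n, MeasurableSet[𝓕 n] {ω | Y n ω ∈ D} := fun n => h.adapted n hD
  have hTm := measurable_atTime h.measurable fun t => h.le t _ (hT t)
  have hτ := fun t => h.le t _ (measurableSet_firstHit h.mono hp hT t)
  have hV : Measurable fun ω => (atTime Y (fun ω => firstHit (fun n => Y n ω ∈ D) (T ω)) ω,
      (firstHit (fun n => Y n ω ∈ D) (T ω)).toNat - (T ω).toNat) :=
    (measurable_atTime h.measurable hτ).prodMk ((measurable_toNat_of_measurableSet hτ).sub
      (measurable_toNat_of_measurableSet fun t => h.le t _ (hT t)))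
  have := Measure.isFiniteMeasure_map (μ.restrict A) (fun ω => (atTime Y T ω,
        (atTime Y (fun ω => firstHit (fun n => Y n ω ∈ D) (T ω)) ω,
          (firstHit (fun n => Y n ω ∈ D) (T ω)).toNat - (T ω).toNat)))
  refine Measure.ext_prod fun {C B} hC hB => ?_
  rw [Measure.map_apply (hTm.prodMk hV) (hC.prod hB), Measure.compProd_apply_prod hC hB,
    setLIntegral_map hC (Kernel.measurable_coe _ hB) hTm, Measure.restrict_restrict (hTm hC),
    ← h.measure_hit_ne_top hD hT hfin
      (MeasurableSet.inter (measurable_pastOf_atTime h.adapted hT hC) hA) hB,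
    Measure.restrict_apply ((hTm.prodMk hV) (hC.prod hB))]
  refine measure_congr (eventuallyEq_set.2 ?_)
  filter_upwards [h.ae_firstHit_ne_top hD hT hfin] with ω hω
  simp only [Set.mem_inter_iff, Set.mem_preimage, Set.mem_prod, Set.mem_ofPred_eq, ne_eq, hω,
    not_false_eq_true, true_and]
  tauto

end StrongMarkov

section WalkKernel

variable {M : ℝ}

/-- The transition kernel of the pair consisting of the increment and the walk. -/
def walkKernel (P : Kernel (Set.Ici (-M)) (Set.Ici (-M))) :
    Kernel (Set.Ici (-M) × ℝ) (Set.Ici (-M) × ℝ) :=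
  (Kernel.id ×ₖ P.comap Prod.fst measurable_fst).map fun q => (q.2, q.1.2 + (q.2 : ℝ))

theorem measurable_walkStep (s : ℝ) :
    Measurable fun y : Set.Ici (-M) => (y, s + (y : ℝ)) :=
  measurable_id.prodMk (measurable_subtype_coe.const_add s)

variable {P : Kernel (Set.Ici (-M)) (Set.Ici (-M))} [IsMarkovKernel P]

theorem walkKernel_apply (z : Set.Ici (-M) × ℝ) :
    walkKernel P z = (P z.1).map fun y : Set.Ici (-M) => (y, z.2 + (y : ℝ)) := by
  have hm : Measurable fun q : (Set.Ici (-M) × ℝ) × Set.Ici (-M) => (q.2, q.1.2 + (q.2 : ℝ)) := by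
    fun_prop
  rw [walkKernel, Kernel.map_apply _ hm, Kernel.prod_apply, Kernel.id_apply, Kernel.comap_apply,
    Measure.dirac_prod, Measure.map_map hm (by fun_prop)]
  rfl

instance : IsMarkovKernel (walkKernel P) :=
  ⟨fun z => by
    rw [walkKernel_apply]
    exact Measure.isProbabilityMeasure_map (measurable_walkStep z.2).aemeasurable⟩

theorem lintegral_walkKernel (z : Set.Ici (-M) × ℝ) {f : Set.Ici (-M) × ℝ → ℝ≥0∞}
    (hf : Measurable f) :
    ∫⁻ z', f z' ∂(walkKernel P z) = ∫⁻ y, f (y, z.2 + (y : ℝ)) ∂(P z.1) := by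
  rw [walkKernel_apply, lintegral_map hf (measurable_walkStep z.2)]

/-- The states above `θ`. -/
def above (M θ : ℝ) : Set (Set.Ici (-M) × ℝ) := {z | θ < z.2}

/-- The states below `θ`. -/
def below (M θ : ℝ) : Set (Set.Ici (-M) × ℝ) := {z | z.2 < θ}

theorem measurableSet_above (θ : ℝ) : MeasurableSet (above M θ) :=
  measurableSet_lt measurable_const measurable_snd

theorem measurableSet_below (θ : ℝ) : MeasurableSet (below M θ) :=
  measurableSet_lt measurable_snd measurable_const

theorem measurable_avoid {Z : Type*} [MeasurableSpace Z] (K : Kernel Z Z) [IsMarkovKernel K]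
    {D : Set Z} (hD : MeasurableSet D) (n : ℕ) : Measurable (avoid K D n) := by
  induction n with
  | zero => exact measurable_const
  | succ n ih => exact ih.setLIntegral_kernel hD.compl

theorem avoid_above (θ : ℝ) (n : ℕ) (x : Set.Ici (-M)) (s : ℝ) :
    avoid (walkKernel P) (above M θ) n (x, s) = surv P (fun y => (y : ℝ)) n x (θ - s) := by
  induction n generalizing x s with
  | zero => rfl
  | succ n ih =>
    have hD := (measurableSet_above (M := M) θ).compl
    change ∫⁻ z' in (above M θ)ᶜ, avoid (walkKernel P) (above M θ) n z' ∂(walkKernel P (x, s))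
      = ∫⁻ y : Set.Ici (-M), trunc (surv P (fun y => (y : ℝ)) n) y (θ - s - y) ∂(P x)
    rw [← lintegral_indicator hD, lintegral_walkKernel _
      ((measurable_avoid _ hD.of_compl n).indicator hD)]
    refine lintegral_congr fun y => ?_
    simp only [Set.indicator, ih]
    simp only [trunc, above, Set.mem_compl_iff, Set.mem_ofPred_eq, not_lt,
      sub_sub]
    simp only [sub_nonneg]

theorem avoid_below (θ : ℝ) (n : ℕ) (x : Set.Ici (-M)) (s : ℝ) :
    avoid (walkKernel P) (below M θ) n (x, s) = surv P (fun y => -(y : ℝ)) n x (s - θ) := by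
  induction n generalizing x s with
  | zero => rfl
  | succ n ih =>
    have hD := (measurableSet_below (M := M) θ).compl
    change ∫⁻ z' in (below M θ)ᶜ, avoid (walkKernel P) (below M θ) n z' ∂(walkKernel P (x, s))
      = ∫⁻ y : Set.Ici (-M), trunc (surv P (fun y => -(y : ℝ)) n) y (s - θ - -y) ∂(P x)
    rw [← lintegral_indicator hD, lintegral_walkKernel _
      ((measurable_avoid _ hD.of_compl n).indicator hD)]
    refine lintegral_congr fun y => ?_
    simp only [Set.indicator, ih]
    simp only [trunc, below, Set.mem_compl_iff, Set.mem_ofPred_eq, not_lt,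
      show s - θ - -(y : ℝ) = s + y - θ by ring, sub_nonneg]

end WalkKernel

section Minorization

variable {M : ℝ}

/-- Lebesgue measure on `[-h, h]`, as a measure on `[-M, ∞)`. -/
def lebIci (M h : ℝ) : Measure (Set.Ici (-M)) :=
  (volume.restrict (Set.Icc (-h) h)).map (Set.projIci (-M))

theorem measurable_projIci (a : ℝ) : Measurable (Set.projIci a) :=
  (measurable_const.max measurable_id).subtype_mk

theorem coe_projIci_of_le {a x : ℝ} (h : a ≤ x) : (Set.projIci a x : ℝ) = x := max_eq_right h

theorem lebIci_apply (h : ℝ) {A : Set (Set.Ici (-M))} (hA : MeasurableSet A) :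
    lebIci M h A = volume (Set.Icc (-h) h ∩ Set.projIci (-M) ⁻¹' A) := by
  rw [lebIci, Measure.map_apply (measurable_projIci _) hA,
    Measure.restrict_apply (measurable_projIci _ hA), Set.inter_comm]

theorem lintegral_lebIci (h : ℝ) {f : Set.Ici (-M) → ℝ≥0∞} (hf : Measurable f) :
    ∫⁻ x, f x ∂(lebIci M h) = ∫⁻ y in Set.Icc (-h) h, f (Set.projIci (-M) y) := by
  rw [lebIci, lintegral_map hf (measurable_projIci _)]

theorem Minorized.exists_smul_lebIci_le {P : Kernel (Set.Ici (-M)) (Set.Ici (-M))}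
    [IsMarkovKernel P] (hM : 0 < M) (hP : Minorized P) :
    ∃ (a : ℝ≥0∞) (h₀ : ℝ), a ≠ 0 ∧ a ≠ ∞ ∧ 0 < h₀ ∧ h₀ ≤ M ∧
      ∀ h ≤ h₀, ∀ x, a • lebIci M h ≤ P x := by
  obtain ⟨α, h, hα, hh, H⟩ := hP
  refine ⟨ENNReal.ofReal (α * (1 / (2 * h))), min h M, by positivity, ENNReal.ofReal_ne_top,
    lt_min hh hM, min_le_right _ _, fun h' hh' x => ?_⟩
  refine Measure.le_iff.2 fun A hA => ?_
  have hfin : volume (Set.Icc (-h) h ∩ Subtype.val '' A) ≠ ∞ :=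
    ne_top_of_le_ne_top (by simp) (measure_mono Set.inter_subset_left)
  have hsub : Set.Icc (-h') h' ∩ Set.projIci (-M) ⁻¹' A ⊆ Set.Icc (-h) h ∩ Subtype.val '' A := by
    rintro y ⟨hy, hyA⟩
    have h1 := hh'.trans (min_le_left _ _)
    have h2 := hh'.trans (min_le_right _ _)
    exact ⟨⟨by linarith [hy.1], by linarith [hy.2]⟩, _, hyA,
      coe_projIci_of_le (by linarith [hy.1])⟩
  have h3 := H x A hA
  rw [← mul_assoc] at h3
  calc (ENNReal.ofReal (α * (1 / (2 * h))) • lebIci M h') A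
      ≤ ENNReal.ofReal (α * (1 / (2 * h))) * volume (Set.Icc (-h) h ∩ Subtype.val '' A) := by
        rw [Measure.smul_apply, smul_eq_mul, lebIci_apply _ hA]
        gcongr
    _ = ENNReal.ofReal (α * (1 / (2 * h)) * volume.real (Set.Icc (-h) h ∩ Subtype.val '' A)) := by
        rw [measureReal_def, ENNReal.ofReal_mul (p := α * (1 / (2 * h))) (by positivity),
          ENNReal.ofReal_toReal hfin]
    _ ≤ P x A := by
        rw [← ENNReal.ofReal_toReal (measure_ne_top (P x) A)]
        exact ENNReal.ofReal_le_ofReal h3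

/-- A nonzero measure below a probability measure is a multiple of a probability measure. -/
theorem exists_smul_probability {E : Type*} [MeasurableSpace E] {m p : Measure E}
    [IsProbabilityMeasure p] (h0 : m ≠ 0) (hle : m ≤ p) :
    ∃ (ε : ℝ≥0∞) (ν : Measure E), IsProbabilityMeasure ν ∧ ε ≠ 0 ∧ ε ≤ 1 ∧ ε • ν = m := by
  have h1 : m Set.univ ≤ 1 := (hle _).trans prob_le_one
  have h2 : m Set.univ ≠ ∞ := ne_top_of_le_ne_top ENNReal.one_ne_top h1
  have h3 : m Set.univ ≠ 0 := fun h => h0 (Measure.measure_univ_eq_zero.1 h)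
  refine ⟨m Set.univ, (m Set.univ)⁻¹ • m, ⟨?_⟩, h3, h1, ?_⟩
  · rw [Measure.smul_apply, smul_eq_mul, ENNReal.inv_mul_cancel h3 h2]
  · rw [smul_smul, ENNReal.mul_inv_cancel h3 h2, one_smul]

theorem lebIci_le_neg_ne_zero {h : ℝ} (hh : 0 < h) (hM : h ≤ M) :
    lebIci M h {y | (y : ℝ) ≤ -(h / 2)} ≠ 0 := by
  rw [lebIci_apply _ (measurableSet_le measurable_subtype_coe measurable_const)]
  have : Set.Icc (-h) (-(h / 2)) ⊆ Set.Icc (-h) h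
      ∩ Set.projIci (-M) ⁻¹' {y | (y : ℝ) ≤ -(h / 2)} := fun y hy => by
    refine ⟨⟨hy.1, by linarith [hy.2]⟩, ?_⟩
    simp only [Set.mem_preimage, Set.mem_ofPred_eq]
    rw [coe_projIci_of_le (by linarith [hy.1])]
    exact hy.2
  refine (lt_of_lt_of_le ?_ (measure_mono this)).ne'
  rw [Real.volume_Icc]
  exact ENNReal.ofReal_pos.2 (by linarith)

theorem lebIci_ge_ne_zero {h : ℝ} (hh : 0 < h) (hM : h ≤ M) :
    lebIci M h {y | -(y : ℝ) ≤ -(h / 2)} ≠ 0 := by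
  have hm : MeasurableSet {y : Set.Ici (-M) | -(y : ℝ) ≤ -(h / 2)} :=
    measurableSet_le measurable_subtype_coe.neg measurable_const
  rw [lebIci_apply _ hm]
  have : Set.Icc (h / 2) h ⊆ Set.Icc (-h) h
      ∩ Set.projIci (-M) ⁻¹' {y | -(y : ℝ) ≤ -(h / 2)} := fun y hy => by
    refine ⟨⟨by linarith [hy.1], hy.2⟩, ?_⟩
    simp only [Set.mem_preimage, Set.mem_ofPred_eq]
    rw [coe_projIci_of_le (by linarith [hy.1])]
    linarith [hy.1]
  refine (lt_of_lt_of_le ?_ (measure_mono this)).ne'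
  rw [Real.volume_Icc]
  exact ENNReal.ofReal_pos.2 (by linarith)

theorem ZeroMean.integrable {P : Kernel (Set.Ici (-M)) (Set.Ici (-M))} [IsMarkovKernel P]
    (hP : ZeroMean P) {π : Measure (Set.Ici (-M))} [IsProbabilityMeasure π]
    (hπ : π.bind P = π) : Integrable (fun x : Set.Ici (-M) => (x : ℝ)) π := by
  refine ⟨measurable_subtype_coe.aestronglyMeasurable, ?_⟩
  rw [HasFiniteIntegral, ← hπ, Measure.lintegral_bind (Kernel.aemeasurable _)
    measurable_subtype_coe.enorm.aemeasurable]
  refine lt_of_le_of_lt (lintegral_mono (g := fun _ => ENNReal.ofReal (2 * |M|)) fun z => ?_)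
    (by rw [lintegral_const, measure_univ, mul_one]; exact ENNReal.ofReal_lt_top)
  have h1 : ∀ x : Set.Ici (-M), ‖(x : ℝ)‖ ≤ x + 2 * |M| := fun x => by
    have := x.2
    rw [Set.mem_Ici] at this
    rw [Real.norm_eq_abs]
    exact abs_le.2 ⟨by linarith [neg_abs_le M, le_abs_self M], by linarith [abs_nonneg M]⟩
  have hi := (hP z).1
  calc ∫⁻ x, ‖(x : ℝ)‖ₑ ∂(P z) = ENNReal.ofReal (∫ x, ‖(x : ℝ)‖ ∂(P z)) :=
        (ofReal_integral_norm_eq_lintegral_enorm hi).symm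
    _ ≤ ENNReal.ofReal (∫ x : Set.Ici (-M), ((x : ℝ) + 2 * |M|) ∂(P z)) :=
        ENNReal.ofReal_le_ofReal (integral_mono hi.norm (hi.add (integrable_const _)) h1)
    _ = ENNReal.ofReal (2 * |M|) := by
        rw [integral_add hi (integrable_const _), (hP z).2]
        simp

theorem ZeroMean.integral_eq_zero {P : Kernel (Set.Ici (-M)) (Set.Ici (-M))} [IsMarkovKernel P]
    (hP : ZeroMean P) {π : Measure (Set.Ici (-M))} [IsProbabilityMeasure π]
    (hπ : π.bind P = π) : ∫ x : Set.Ici (-M), (x : ℝ) ∂π = 0 := by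
  rw [← hπ, Doeblin.integral_bind (by rw [hπ]; exact hP.integrable hπ)]
  exact integral_eq_zero_of_ae (ae_of_all _ fun z => (hP z).2)

variable {P : Kernel (Set.Ici (-M)) (Set.Ici (-M))} [IsMarkovKernel P]

theorem iInf_avoid_eq_zero (hM : 0 < M) (hminor : Minorized P) (hmean : ZeroMean P) (θ : ℝ)
    (z : Set.Ici (-M) × ℝ) :
    ⨅ n, avoid (walkKernel P) (above M θ) n z = 0 ∧
      ⨅ n, avoid (walkKernel P) (below M θ) n z = 0 := by
  obtain ⟨a, h, ha0, -, hh, hhM, hle⟩ := hminor.exists_smul_lebIci_le hM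
  have hne : a • lebIci M h ≠ 0 := fun h0 => lebIci_le_neg_ne_zero hh hhM (by
    have := congrArg (fun m => m {y : Set.Ici (-M) | (y : ℝ) ≤ -(h / 2)}) h0
    simpa [ha0] using this)
  obtain ⟨ε, ν, hν, hε0, hε1, hεν⟩ := exists_smul_probability hne (hle h le_rfl z.1)
  have hle' : ∀ x, ε • ν ≤ P x := fun x => hεν ▸ hle h le_rfl x
  obtain ⟨π, hπp, hπ, hνπ⟩ := Doeblin.exists_invariant P ν hε0 hε1 hle'
  have hν0 : ∀ s, lebIci M h s ≠ 0 → ν s ≠ 0 := fun s hs hs0 => by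
    have := congrArg (fun m => m s) hεν
    simp [hs0, ha0, hs] at this
  simp_rw [avoid_above θ _ z.1 z.2, avoid_below θ _ z.1 z.2]
  constructor
  · exact iInf_surv_eq_zero hle' hε0 hε1 hπ hνπ measurable_subtype_coe (hmean.integrable hπ)
      (hmean.integral_eq_zero hπ) (half_pos hh) (hν0 _ (lebIci_le_neg_ne_zero hh hhM)) _ _
  · have h0 : ∫ x : Set.Ici (-M), -(x : ℝ) ∂π = 0 := by
      rw [integral_neg, hmean.integral_eq_zero hπ, neg_zero]
    exact iInf_surv_eq_zero hle' hε0 hε1 hπ hνπ measurable_subtype_coe.neg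
      (hmean.integrable hπ).neg h0 (half_pos hh) (hν0 _ (lebIci_ge_ne_zero hh hhM)) _ _

theorem isMarkovKernel_hit_above (hM : 0 < M) (hminor : Minorized P) (hmean : ZeroMean P) (θ : ℝ) :
    IsMarkovKernel (hit (walkKernel P) (measurableSet_above (M := M) θ)) :=
  isMarkovKernel_hit fun z => (iInf_avoid_eq_zero hM hminor hmean θ z).1

theorem isMarkovKernel_hit_below (hM : 0 < M) (hminor : Minorized P) (hmean : ZeroMean P) (θ : ℝ) :
    IsMarkovKernel (hit (walkKernel P) (measurableSet_below (M := M) θ)) :=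
  isMarkovKernel_hit fun z => (iInf_avoid_eq_zero hM hminor hmean θ z).2

end Minorization

section Spreading

variable {M : ℝ} {P : Kernel (Set.Ici (-M)) (Set.Ici (-M))} [IsMarkovKernel P] {a : ℝ≥0∞}
  {h θ b c : ℝ} {f : Set.Ici (-M) × ℝ → ℝ≥0∞}

theorem measurable_comp_projIci (hf : Measurable f) :
    Measurable fun p : ℝ × ℝ => f (Set.projIci (-M) p.1, p.2) :=
  hf.comp (((measurable_projIci _).comp measurable_fst).prodMk measurable_snd)

theorem mul_lintegral_step_le (hhM : h ≤ M) (hle : ∀ x, a • lebIci M h ≤ P x) (hf : Measurable f)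
    (hsup : ∀ z, ∫⁻ z' in (above M θ)ᶜ, f z' ∂(walkKernel P z) ≤ f z) (x : Set.Ici (-M)) {s : ℝ}
    (hs : s ≤ θ - h) :
    a * ∫⁻ y in Set.Icc (-h) h, f (Set.projIci (-M) y, s + y) ≤ f (x, s) := by
  have hD := (measurableSet_above (M := M) θ).compl
  refine le_trans ?_ (hsup (x, s))
  have hfi := hf.indicator hD
  rw [← lintegral_indicator hD, lintegral_walkKernel _ hfi]
  have hg : Measurable fun y : Set.Ici (-M) => (above M θ)ᶜ.indicator f (y, s + (y : ℝ)) :=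
    hfi.comp (measurable_walkStep s)
  refine le_trans ?_ (lintegral_mono' (hle x) le_rfl)
  rw [lintegral_smul_measure, lintegral_lebIci _ hg, smul_eq_mul]
  gcongr a * ?_
  refine setLIntegral_mono' measurableSet_Icc fun y hy => ?_
  rw [coe_projIci_of_le (by linarith [hy.1]), Set.indicator_of_mem]
  simp only [above, Set.mem_compl_iff, Set.mem_ofPred_eq, not_lt]
  linarith [hy.2]

theorem mul_lintegral_two_steps_le (hh : 0 < h) (hhM : h ≤ M)
    (hle : ∀ x, a • lebIci M h ≤ P x) (hf : Measurable f)
    (hsup : ∀ z, ∫⁻ z' in (above M θ)ᶜ, f z' ∂(walkKernel P z) ≤ f z) (x : Set.Ici (-M)) {s : ℝ}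
    (hs : s ≤ θ - 2 * h) :
    a ^ 2 * ∫⁻ v in Set.Icc (s - h / 2) (s + h / 2), ∫⁻ y in Set.Icc (-(h / 4)) (h / 4),
      f (Set.projIci (-M) y, v) ≤ f (x, s) := by
  have hm := measurable_comp_projIci hf
  refine le_trans ?_ (mul_lintegral_step_le hhM hle hf hsup x (s := s) (by linarith))
  have h1 : ∫⁻ y₁ in Set.Icc (-h) h, a * ∫⁻ y₂ in Set.Icc (-h) h,
        f (Set.projIci (-M) y₂, s + y₁ + y₂)
      ≤ ∫⁻ y in Set.Icc (-h) h, f (Set.projIci (-M) y, s + y) :=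
    setLIntegral_mono' measurableSet_Icc fun y hy =>
      mul_lintegral_step_le hhM hle hf hsup _ (by linarith [hy.2])
  have hm3 : Measurable fun p : ℝ × ℝ => f (Set.projIci (-M) p.2, s + p.1 + p.2) :=
    hm.comp (measurable_snd.prodMk ((measurable_fst.const_add s).add measurable_snd))
  rw [lintegral_const_mul _ (Measurable.lintegral_prod_right' hm3),
    lintegral_lintegral_swap hm3.aemeasurable] at h1
  rw [pow_two, mul_assoc]
  refine mul_le_mul_right (le_trans (mul_le_mul_right ?_ a) h1) a
  rw [lintegral_lintegral_swap (f := fun v y => f (Set.projIci (-M) y, v))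
    (hm.comp measurable_swap).aemeasurable]
  refine le_trans (setLIntegral_mono' measurableSet_Icc fun y hy => ?_)
    (lintegral_mono_set (Set.Icc_subset_Icc (by linarith) (by linarith)))
  rw [← lintegral_indicator measurableSet_Icc, ← lintegral_indicator measurableSet_Icc,
    ← lintegral_add_left_eq_self _ (s + y)]
  refine lintegral_mono fun v => ?_
  by_cases hv : s + y + v ∈ Set.Icc (s - h / 2) (s + h / 2)
  · rw [Set.indicator_of_mem hv, Set.indicator_of_mem, add_right_comm]
    exact ⟨by linarith [hv.1, hy.2], by linarith [hv.2, hy.1]⟩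
  · rw [Set.indicator_of_notMem hv]
    exact zero_le

/-- A function that is superharmonic for the walk killed above `θ` is bounded below, uniformly
on a strip of levels, by a multiple of its average on one fixed set. -/
theorem exists_mul_lintegral_le (hh : 0 < h) (hhM : h ≤ M) (ha0 : a ≠ 0) (ha : a ≠ ∞)
    (hle : ∀ x, a • lebIci M h ≤ P x) (hc : c ≤ θ - 2 * h) :
    ∃ ε : ℝ≥0∞, ε ≠ 0 ∧ ε ≠ ∞ ∧ ∀ f : Set.Ici (-M) × ℝ → ℝ≥0∞, Measurable f →
      (∀ z, ∫⁻ z' in (above M θ)ᶜ, f z' ∂(walkKernel P z) ≤ f z) →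
      ∀ x, ∀ s ∈ Set.Icc b c, ε * ∫⁻ v in Set.Icc b (b + h / 4),
        ∫⁻ y in Set.Icc (-(h / 4)) (h / 4), f (Set.projIci (-M) y, v) ≤ f (x, s) := by
  set κ : ℝ≥0∞ := min 1 (a ^ 2 * ENNReal.ofReal (h / 4) * ENNReal.ofReal (h / 2)) with hκ
  have hκ0 : κ ≠ 0 := by
    have h4 : ENNReal.ofReal (h / 4) ≠ 0 := (ENNReal.ofReal_pos.2 (by positivity)).ne'
    have h2 : ENNReal.ofReal (h / 2) ≠ 0 := (ENNReal.ofReal_pos.2 (by positivity)).ne'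
    have h0 := mul_ne_zero (mul_ne_zero (pow_ne_zero 2 ha0) h4) h2
    exact (lt_min one_pos (pos_iff_ne_zero.2 h0)).ne'
  have hκ1 : κ ≤ 1 := min_le_left _ _
  have hκt : κ ≠ ∞ := ne_top_of_le_ne_top ENNReal.one_ne_top hκ1
  obtain ⟨N, hN⟩ := exists_nat_ge ((c - b) / (h / 4))
  rw [div_le_iff₀ (by positivity)] at hN
  refine ⟨a ^ 2 * κ ^ N, mul_ne_zero (pow_ne_zero 2 ha0) (pow_ne_zero N hκ0),
    ENNReal.mul_ne_top (ENNReal.pow_ne_top ha) (ENNReal.pow_ne_top hκt), fun f hf hsup => ?_⟩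
  set Ψ : ℝ → ℝ≥0∞ := fun v => ∫⁻ y in Set.Icc (-(h / 4)) (h / 4), f (Set.projIci (-M) y, v)
    with hΨ
  have htwo : ∀ x s, s ≤ c → a ^ 2 * ∫⁻ v in Set.Icc (s - h / 2) (s + h / 2), Ψ v ≤ f (x, s) :=
    fun x s hs => mul_lintegral_two_steps_le hh hhM hle hf hsup x (hs.trans hc)
  set m₀ := ∫⁻ v in Set.Icc b (b + h / 4), Ψ v with hm₀
  have claim : ∀ n : ℕ, ∀ s, b ≤ s → s ≤ b + (n + 2) * (h / 4) → s ≤ c → ∀ x,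
      a ^ 2 * κ ^ n * m₀ ≤ f (x, s) := fun n => by
    induction n with
    | zero =>
      intro s hbs hs hsc x
      refine le_trans ?_ (htwo x s hsc)
      rw [pow_zero, mul_one]
      push_cast at hs
      refine mul_le_mul_right (lintegral_mono_set (Set.Icc_subset_Icc ?_ ?_)) _ <;> linarith
    | succ n ih =>
      intro s hbs hs hsc x
      rcases le_total s (b + (n + 2) * (h / 4)) with hs' | hs'
      · refine le_trans ?_ (ih s hbs hs' hsc x)
        gcongr a ^ 2 * ?_ * _
        exact pow_le_pow_of_le_one zero_le hκ1 n.le_succ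
      · push_cast at hs
        have hn0 : (0 : ℝ) ≤ n * (h / 4) := by positivity
        refine le_trans ?_ (htwo x s hsc)
        have hΨle : ∀ v ∈ Set.Icc (s - h / 2) (s - h / 4),
            ENNReal.ofReal (h / 2) * (a ^ 2 * κ ^ n * m₀) ≤ Ψ v := fun v hv => by
          have := setLIntegral_mono' (μ := volume) (s := Set.Icc (-(h / 4)) (h / 4))
            measurableSet_Icc (f := fun _ => a ^ 2 * κ ^ n * m₀)
            (g := fun y => f (Set.projIci (-M) y, v)) fun y _ => ih v (by linarith [hv.1])
              (by linarith [hv.2]) (by linarith [hv.2]) _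
          rw [setLIntegral_const, Real.volume_Icc, mul_comm] at this
          rwa [show h / 4 - -(h / 4) = h / 2 by ring] at this
        have hint := setLIntegral_mono' (μ := volume) measurableSet_Icc hΨle
        rw [setLIntegral_const, Real.volume_Icc,
          show s - h / 4 - (s - h / 2) = h / 4 by ring] at hint
        calc a ^ 2 * κ ^ (n + 1) * m₀ = κ * (a ^ 2 * κ ^ n * m₀) := by ring
          _ ≤ (a ^ 2 * ENNReal.ofReal (h / 4) * ENNReal.ofReal (h / 2)) * (a ^ 2 * κ ^ n * m₀) := by
              gcongr
              exact min_le_right _ _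
          _ = a ^ 2 * (ENNReal.ofReal (h / 2) * (a ^ 2 * κ ^ n * m₀) * ENNReal.ofReal (h / 4)) := by
              ring
          _ ≤ a ^ 2 * ∫⁻ v in Set.Icc (s - h / 2) (s - h / 4), Ψ v := by gcongr
          _ ≤ a ^ 2 * ∫⁻ v in Set.Icc (s - h / 2) (s + h / 2), Ψ v := by
              refine mul_le_mul_right (lintegral_mono_set (Set.Icc_subset_Icc le_rfl ?_)) _
              linarith
  intro x s hs
  exact claim N s hs.1 (by nlinarith [hs.2]) hs.2 x

end Spreading

section CycleKernel

variable {M θlo θhi : ℝ}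

/-- The law of the entrance above `θhi` and of the following entrance below `θlo`, with the time
between the two. -/
def cycle (P : Kernel (Set.Ici (-M)) (Set.Ici (-M))) (θlo θhi : ℝ) :
    Kernel (Set.Ici (-M) × ℝ) ((Set.Ici (-M) × ℝ) × ((Set.Ici (-M) × ℝ) × ℕ)) :=
  (hit (walkKernel P) (measurableSet_above θhi)).fst ⊗ₖ
    Kernel.prodMkLeft (Set.Ici (-M) × ℝ) (hit (walkKernel P) (measurableSet_below θlo))

/-- The crossing data of a cycle. -/
def cycleData (p : (Set.Ici (-M) × ℝ) × ((Set.Ici (-M) × ℝ) × ℕ)) : ℝ × ℝ × ℝ × ℝ × ℕ :=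
  (p.1.1, p.1.2, p.2.1.1, p.2.1.2, p.2.2)

theorem measurable_cycleData : Measurable (cycleData (M := M)) := by
  unfold cycleData
  fun_prop

theorem measurableSet_crossingSpace : MeasurableSet (crossingSpace M θlo θhi) :=
  measurableSet_Ioi.prod (measurableSet_Ioi.prod (measurableSet_Ico.prod
    (measurableSet_Ico.prod measurableSet_Ici)))

/-- The state at the end of a cycle, projected to the possible states. -/
def endState (M θlo : ℝ) (u : ℝ × ℝ × ℝ × ℝ × ℕ) : Set.Ici (-M) × ℝ :=
  (Set.projIci (-M) u.2.2.1, min θlo (max (θlo - M) u.2.2.2.1))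

theorem measurable_endState : Measurable (endState M θlo) := by
  unfold endState
  exact ((measurable_projIci _).comp (by fun_prop)).prodMk (by fun_prop)

theorem endState_cycleData {p : (Set.Ici (-M) × ℝ) × ((Set.Ici (-M) × ℝ) × ℕ)}
    (hp : cycleData p ∈ crossingSpace M θlo θhi) : endState M θlo (cycleData p) = p.2.1 := by
  obtain ⟨-, -, -, hs, -⟩ := hp
  change p.2.1.2 ∈ _ at hs
  refine Prod.ext (Subtype.ext ?_) ?_
  · exact coe_projIci_of_le p.2.1.1.2
  · change min θlo (max (θlo - M) p.2.1.2) = p.2.1.2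
    rw [max_eq_right hs.1, min_eq_right hs.2.le]

theorem endState_mem_Icc (hM : 0 ≤ M) (u : ℝ × ℝ × ℝ × ℝ × ℕ) :
    (endState M θlo u).2 ∈ Set.Icc (θlo - M) θlo :=
  ⟨le_min (by linarith) (le_max_left _ _), min_le_left _ _⟩

/-- The transition kernel of the crossing data. -/
def crossingKernel (P : Kernel (Set.Ici (-M)) (Set.Ici (-M))) (θlo θhi : ℝ) :
    Kernel (ℝ × ℝ × ℝ × ℝ × ℕ) (ℝ × ℝ × ℝ × ℝ × ℕ) :=
  ((cycle P θlo θhi).map cycleData).comap (endState M θlo) measurable_endState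

theorem crossingKernel_apply (P : Kernel (Set.Ici (-M)) (Set.Ici (-M))) (u : ℝ × ℝ × ℝ × ℝ × ℕ)
    {B : Set (ℝ × ℝ × ℝ × ℝ × ℕ)} (hB : MeasurableSet B) :
    crossingKernel P θlo θhi u B = cycle P θlo θhi (endState M θlo u) (cycleData ⁻¹' B) := by
  rw [crossingKernel, Kernel.comap_apply, Kernel.map_apply' _ measurable_cycleData _ hB]

variable {P : Kernel (Set.Ici (-M)) (Set.Ici (-M))}
  [IsMarkovKernel (hit (walkKernel P) (measurableSet_above (M := M) θhi))]
  [IsMarkovKernel (hit (walkKernel P) (measurableSet_below (M := M) θlo))]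

instance : IsMarkovKernel (cycle P θlo θhi) := by
  unfold cycle
  infer_instance

theorem measurable_hit_slice {B : Set ((Set.Ici (-M) × ℝ) × ((Set.Ici (-M) × ℝ) × ℕ))}
    (hB : MeasurableSet B) : Measurable fun l =>
      hit (walkKernel P) (measurableSet_below (M := M) θlo) l (Prod.mk l ⁻¹' B) :=
  Kernel.measurable_kernel_prodMk_left hB

theorem cycle_apply (z : Set.Ici (-M) × ℝ)
    {B : Set ((Set.Ici (-M) × ℝ) × ((Set.Ici (-M) × ℝ) × ℕ))} (hB : MeasurableSet B) :
    cycle P θlo θhi z B = ∫⁻ p, hit (walkKernel P) (measurableSet_below (M := M) θlo) p.1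
      (Prod.mk p.1 ⁻¹' B) ∂(hit (walkKernel P) (measurableSet_above (M := M) θhi) z) := by
  rw [cycle, Kernel.compProd_apply hB, Kernel.lintegral_fst _ _ ]
  · rfl
  · exact measurable_hit_slice hB

/-- The cycle law is superharmonic for the walk killed above `θhi`. -/
theorem lintegral_cycle_le (z : Set.Ici (-M) × ℝ)
    {B : Set ((Set.Ici (-M) × ℝ) × ((Set.Ici (-M) × ℝ) × ℕ))} (hB : MeasurableSet B) :
    ∫⁻ z' in (above M θhi)ᶜ, cycle P θlo θhi z' B ∂(walkKernel P z) ≤ cycle P θlo θhi z B := by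
  simp_rw [cycle_apply _ hB]
  exact le_lintegral_hit z (measurable_hit_slice hB)

/-- From a state not above `θhi`, the cycle data lie in the crossing space. -/
theorem cycle_crossingSpace_compl [IsMarkovKernel P] (hlt : θlo < θhi) {z : Set.Ici (-M) × ℝ}
    (hz : z ∉ above M θhi) :
    cycle P θlo θhi z (cycleData ⁻¹' (crossingSpace M θlo θhi)ᶜ) = 0 := by
  set N₁ : Set (Set.Ici (-M) × ℝ) := {z | (z.1 : ℝ) ≤ 0} ∪ (above M θhi)ᶜ with hN₁
  set N₂ : Set (Set.Ici (-M) × ℝ) :=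
    {z | 0 ≤ (z.1 : ℝ)} ∪ {z | z.2 < θlo - M} ∪ (below M θlo)ᶜ with hN₂
  have hN₁m : MeasurableSet N₁ :=
    (measurableSet_le (measurable_subtype_coe.comp measurable_fst) measurable_const).union
      (measurableSet_above θhi).compl
  have hN₂m : MeasurableSet N₂ :=
    ((measurableSet_le measurable_const (measurable_subtype_coe.comp measurable_fst)).union
      (measurableSet_lt measurable_snd measurable_const)).union (measurableSet_below θlo).compl
  have h1 : hit (walkKernel P) (measurableSet_above (M := M) θhi) z
      (N₁ ×ˢ Set.univ ∪ Set.univ ×ˢ {0}) = 0 := by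
    refine hit_eq_zero_of_step hN₁m (fun w hw => ?_) hz
    rw [walkKernel_apply, Measure.map_apply (measurable_walkStep w.2)
      (hN₁m.inter (measurableSet_above θhi))]
    refine measure_mono_null (fun y hy => ?_) (measure_empty (μ := P w.1))
    exfalso
    simp only [hN₁, above, Set.mem_preimage, Set.mem_inter_iff, Set.mem_union, Set.mem_compl_iff,
      Set.mem_ofPred_eq, not_lt] at hy hw
    rcases hy with ⟨hy1 | hy1, hy2⟩ <;> linarith
  have h2 : ∀ l ∈ above M θhi, hit (walkKernel P) (measurableSet_below (M := M) θlo) l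
      (N₂ ×ˢ Set.univ ∪ Set.univ ×ˢ {0}) = 0 := fun l hl => by
    refine hit_eq_zero_of_step hN₂m (fun w hw => ?_) fun hl' => ?_
    · rw [walkKernel_apply, Measure.map_apply (measurable_walkStep w.2)
        (hN₂m.inter (measurableSet_below θlo))]
      refine measure_mono_null (fun y hy => ?_) (measure_empty (μ := P w.1))
      exfalso
      have hyM : -M ≤ (y : ℝ) := y.2
      simp only [hN₂, below, Set.mem_preimage, Set.mem_inter_iff, Set.mem_union,
        Set.mem_compl_iff, Set.mem_ofPred_eq, not_lt] at hy hw
      rcases hy with ⟨(hy1 | hy1) | hy1, hy2⟩ <;> linarith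
    · simp only [above, below, Set.mem_ofPred_eq] at hl hl'
      linarith
  have hB := measurable_cycleData (M := M) (measurableSet_crossingSpace (M := M) (θlo := θlo)
    (θhi := θhi)).compl
  rw [cycle_apply _ hB]
  refine (lintegral_eq_zero_iff ((measurable_hit_slice hB).comp measurable_fst)).2 ?_
  have h3 : ∀ᵐ p ∂(hit (walkKernel P) (measurableSet_above (M := M) θhi) z), p.1 ∉ N₁ := by
    refine measure_mono_null (fun p hp => ?_) h1
    simp only [Set.mem_compl_iff, Set.mem_ofPred_eq, not_not] at hp
    exact Or.inl ⟨hp, trivial⟩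
  filter_upwards [h3] with p hp
  simp only [hN₁, Set.mem_union, Set.mem_ofPred_eq, Set.mem_compl_iff, not_or, not_le, not_not]
    at hp
  refine measure_mono_null (fun q hq => ?_) (h2 p.1 hp.2)
  by_contra hcon
  simp only [hN₂, below, Set.mem_union, Set.mem_prod, Set.mem_univ, and_true, true_and,
    Set.mem_compl_iff, Set.mem_ofPred_eq, Set.mem_singleton_iff, not_or, not_le, not_lt] at hcon
  refine hq ⟨hp.1, hp.2, ⟨q.1.1.2, ?_⟩, ⟨?_, ?_⟩, ?_⟩
  · exact hcon.1.1.1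
  · exact hcon.1.1.2
  · exact hcon.1.2
  · exact Nat.one_le_iff_ne_zero.2 hcon.2

instance : IsMarkovKernel (crossingKernel P θlo θhi) := by
  have := Kernel.IsMarkovKernel.map (cycle P θlo θhi) measurable_cycleData
  unfold crossingKernel
  infer_instance

theorem crossingKernel_crossingSpace [IsMarkovKernel P] (hM : 0 ≤ M) (hlt : θlo < θhi)
    (u : ℝ × ℝ × ℝ × ℝ × ℕ) :
    crossingKernel P θlo θhi u (crossingSpace M θlo θhi) = 1 := by
  rw [← prob_compl_eq_zero_iff measurableSet_crossingSpace,
    crossingKernel_apply P _ measurableSet_crossingSpace.compl]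
  refine cycle_crossingSpace_compl hlt fun h => ?_
  have h1 := (endState_mem_Icc (θlo := θlo) hM u).2
  simp only [above, Set.mem_ofPred_eq] at h
  linarith

/-- The crossing kernel satisfies Doeblin's condition. -/
theorem exists_smul_le_crossingKernel [IsMarkovKernel P] (hM : 0 < M) (hminor : Minorized P)
    (hlo : θlo < 0) (hhi : 0 < θhi) :
    ∃ (ε : ℝ≥0∞) (ν : Measure (ℝ × ℝ × ℝ × ℝ × ℕ)), IsProbabilityMeasure ν ∧ ε ≠ 0 ∧ ε ≤ 1 ∧
      ∀ u, ε • ν ≤ crossingKernel P θlo θhi u := by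
  obtain ⟨a, h₀, ha0, ha, hh₀, hh₀M, hle⟩ := hminor.exists_smul_lebIci_le hM
  set h := min h₀ (θhi / 2) with hh
  have hpos : 0 < h := lt_min hh₀ (half_pos hhi)
  have hhM : h ≤ M := (min_le_left _ _).trans hh₀M
  have hc : θlo ≤ θhi - 2 * h := by linarith [min_le_right h₀ (θhi / 2)]
  obtain ⟨c, hc0, -, H⟩ := exists_mul_lintegral_le (P := P) (θ := θhi) (b := θlo - M) (c := θlo)
    hpos hhM ha0 ha (hle h (min_le_left _ _)) hc
  set lam : Measure (Set.Ici (-M) × ℝ) :=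
    ((volume.restrict (Set.Icc (θlo - M) (θlo - M + h / 4))).prod
      (volume.restrict (Set.Icc (-(h / 4)) (h / 4)))).map
        fun p => (Set.projIci (-M) p.2, p.1) with hlam
  have hpm : Measurable fun p : ℝ × ℝ => (Set.projIci (-M) p.2, p.1) :=
    ((measurable_projIci _).comp measurable_snd).prodMk measurable_fst
  have hlamf : ∀ f : Set.Ici (-M) × ℝ → ℝ≥0∞, Measurable f → ∫⁻ z, f z ∂lam
      = ∫⁻ v in Set.Icc (θlo - M) (θlo - M + h / 4), ∫⁻ y in Set.Icc (-(h / 4)) (h / 4),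
        f (Set.projIci (-M) y, v) := fun f hf => by
    rw [hlam, lintegral_map hf hpm]
    exact lintegral_prod _ (hf.comp hpm).aemeasurable
  set m : Measure (ℝ × ℝ × ℝ × ℝ × ℕ) := c • (lam.bind (cycle P θlo θhi)).map cycleData with hm
  have hmle : ∀ u, m ≤ crossingKernel P θlo θhi u := fun u => by
    refine Measure.le_iff.2 fun B hB => ?_
    have hB' := measurable_cycleData (M := M) hB
    have hf : Measurable fun z => cycle P θlo θhi z (cycleData ⁻¹' B) :=
      Kernel.measurable_coe _ hB'
    rw [crossingKernel_apply P _ hB, hm, Measure.smul_apply, smul_eq_mul,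
      Measure.map_apply measurable_cycleData hB, Measure.bind_apply hB' (Kernel.aemeasurable _),
      hlamf _ hf]
    exact H _ hf (fun z => lintegral_cycle_le z hB') _ _ (endState_mem_Icc hM.le u)
  have hm0 : m ≠ 0 := by
    rw [← Measure.measure_univ_pos, hm, Measure.smul_apply, smul_eq_mul,
      Measure.map_apply measurable_cycleData MeasurableSet.univ, Set.preimage_univ,
      Measure.bind_apply MeasurableSet.univ (Kernel.aemeasurable _)]
    simp only [measure_univ]
    rw [hlamf _ measurable_const]
    simp only [lintegral_const, Measure.restrict_apply MeasurableSet.univ, Set.univ_inter,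
      Real.volume_Icc, one_mul]
    refine ENNReal.mul_pos hc0 (mul_ne_zero ?_ ?_) <;>
    exact (ENNReal.ofReal_pos.2 (by linarith)).ne'
  obtain ⟨ε, ν, hν, hε0, hε1, hεν⟩ := exists_smul_probability hm0 (hmle (0, 0, 0, 0, 0))
  exact ⟨ε, ν, hν, hε0, hε1, fun u => hεν ▸ hmle u⟩

end CycleKernel

section WalkState

variable {Ω : Type*} {M : ℝ} {X : ℕ → Ω → Set.Ici (-M)} {S₀ : Ω → ℝ}

/-- The increment and the walk at time `n`. -/
def walkState (S₀ : Ω → ℝ) (X : ℕ → Ω → Set.Ici (-M)) (n : ℕ) (ω : Ω) : Set.Ici (-M) × ℝ :=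
  (X n ω, walk (S₀ ω) (fun k => (X k ω : ℝ)) n)

/-- The information available at time `n`. -/
@[reducible] def infoAt (S₀ : Ω → ℝ) (X : ℕ → Ω → Set.Ici (-M)) (n : ℕ) : MeasurableSpace Ω :=
  MeasurableSpace.comap (fun ω => (S₀ ω, past X n ω)) inferInstance

/-- The walk as a function of the initial value and the trajectory of increments. -/
def walkOfPast (n : ℕ) (p : ℝ × (Set.Iic n → Set.Ici (-M))) : ℝ :=
  p.1 + ∑ k ∈ (Finset.Icc 1 n).attach, (p.2 ⟨k, (Finset.mem_Icc.1 k.2).2⟩ : ℝ)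

theorem measurable_walkOfPast (n : ℕ) : Measurable (walkOfPast (M := M) n) :=
  measurable_fst.add (Finset.measurable_fun_sum _ fun _ _ =>
    measurable_subtype_coe.comp ((measurable_pi_apply _).comp measurable_snd))

theorem walkOfPast_past (n : ℕ) (ω : Ω) :
    walkOfPast n (S₀ ω, past X n ω) = walk (S₀ ω) (fun k => (X k ω : ℝ)) n := by
  simp only [walkOfPast, walk, past]
  rw [Finset.sum_attach (Finset.Icc 1 n) fun k => (X k ω : ℝ)]

theorem walkState_succ (n : ℕ) (ω : Ω) : walkState S₀ X (n + 1) ω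
    = (X (n + 1) ω, (walkState S₀ X n ω).2 + (X (n + 1) ω : ℝ)) := by
  simp only [walkState, walk]
  rw [Finset.sum_Icc_succ_top (by lia), add_assoc]

variable [mΩ : MeasurableSpace Ω] {μ : Measure Ω} [IsProbabilityMeasure μ]
  {P : Kernel (Set.Ici (-M)) (Set.Ici (-M))} [IsMarkovKernel P]

theorem isAdaptedMarkov_walkState (hX : IsMarkovChain μ X P) (hS₀ : Measurable S₀)
    (hindep : IndepFun S₀ (fun ω k => X k ω) μ) :
    IsAdaptedMarkov μ (infoAt S₀ X) (walkState S₀ X) (walkKernel P) := by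
  have hp := measurable_past hX.measurable
  have hW : ∀ n, Measurable fun ω => (S₀ ω, past X n ω) := fun n => hS₀.prodMk (hp n)
  refine ⟨fun n => (hW n).comap_le, fun n m hnm => ?_, fun n => ?_, ?_⟩
  · have hr : Measurable fun p : ℝ × (Set.Iic m → Set.Ici (-M)) =>
        (p.1, fun i : Set.Iic n => p.2 ⟨i, i.2.trans hnm⟩) :=
      measurable_fst.prodMk (measurable_pi_lambda _ fun i =>
        (measurable_pi_apply _).comp measurable_snd)
    exact (hr.comp (comap_measurable fun ω => (S₀ ω, past X m ω))).comap_le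
  · have hg : Measurable fun p : ℝ × (Set.Iic n → Set.Ici (-M)) =>
        (p.2 (lastIdx n), walkOfPast n p) :=
      ((measurable_pi_apply _).comp measurable_snd).prodMk (measurable_walkOfPast n)
    convert hg.comp (comap_measurable fun ω => (S₀ ω, past X n ω)) using 1
    funext ω
    exact Prod.ext rfl (walkOfPast_past n ω).symm
  · rintro n _ ⟨A, hA, rfl⟩ B hB
    have hind : IndepFun S₀ (fun ω => (past X n ω, X (n + 1) ω)) μ := by
      have hφ : Measurable fun x : ℕ → Set.Ici (-M) =>
          ((fun i : Set.Iic n => x i : Set.Iic n → Set.Ici (-M)), x (n + 1)) :=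
        (measurable_pi_lambda _ fun i => measurable_pi_apply _).prodMk (measurable_pi_apply _)
      exact hindep.comp measurable_id hφ
    have hind' : IndepFun S₀ (past X n) μ := hind.comp measurable_id measurable_fst
    have hV : Measurable fun ω => (past X n ω, X (n + 1) ω) := (hp n).prodMk (hX.measurable _)
    have hlaw := (indepFun_iff_map_prod_eq_prod_map_map hS₀.aemeasurable hV.aemeasurable).1 hind
    have hlaw' := (indepFun_iff_map_prod_eq_prod_map_map hS₀.aemeasurable
      (hp n).aemeasurable).1 hind'
    have := Measure.isProbabilityMeasure_map (μ := μ) (hp n).aemeasurable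
    have := Measure.isProbabilityMeasure_map (μ := μ) hS₀.aemeasurable
    have hwm := measurable_walkOfPast (M := M) n
    let C : Set (ℝ × ((Set.Iic n → Set.Ici (-M)) × Set.Ici (-M))) :=
      {q | (q.1, q.2.1) ∈ A ∧ (q.2.2, walkOfPast n (q.1, q.2.1) + (q.2.2 : ℝ)) ∈ B}
    have hg1 : Measurable fun q : ℝ × ((Set.Iic n → Set.Ici (-M)) × Set.Ici (-M)) =>
        (q.1, q.2.1) := by fun_prop
    have hg2 : Measurable fun q : ℝ × ((Set.Iic n → Set.Ici (-M)) × Set.Ici (-M)) =>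
        (q.2.2, walkOfPast n (q.1, q.2.1) + (q.2.2 : ℝ)) :=
      (measurable_snd.comp measurable_snd).prodMk ((hwm.comp hg1).add
        (measurable_subtype_coe.comp (measurable_snd.comp measurable_snd)))
    have hC : MeasurableSet C := (hg1 hA).inter (hg2 hB)
    have hkm : Measurable fun p : ℝ × (Set.Iic n → Set.Ici (-M)) =>
        walkKernel P (p.2 (lastIdx n), walkOfPast n p) B :=
      (Kernel.measurable_coe _ hB).comp
        (((measurable_pi_apply _).comp measurable_snd).prodMk hwm)
    have h1 : (fun ω => (S₀ ω, past X n ω)) ⁻¹' A ∩ walkState S₀ X (n + 1) ⁻¹' B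
        = (fun ω => (S₀ ω, (past X n ω, X (n + 1) ω))) ⁻¹' C := by
      ext ω
      simp only [Set.mem_inter_iff, Set.mem_preimage, walkState_succ, C, Set.mem_ofPred_eq,
        walkOfPast_past]
      rfl
    rw [h1, ← Measure.map_apply (hS₀.prodMk hV) hC, hlaw, Measure.prod_apply hC, hX.map_past]
    have h2 : ∀ s, MeasurableSet (Prod.mk s ⁻¹' C) := fun s => measurable_prodMk_left hC
    simp_rw [Measure.compProd_apply (h2 _)]
    have h3 : ∀ s (p : Set.Iic n → Set.Ici (-M)),
        (P.comap (fun p : Set.Iic n → Set.Ici (-M) => p (lastIdx n)) (measurable_pi_apply _)) p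
          (Prod.mk p ⁻¹' (Prod.mk s ⁻¹' C))
        = A.indicator (fun p => walkKernel P (p.2 (lastIdx n), walkOfPast n p) B) (s, p) :=
      fun s p => by
        rw [Kernel.comap_apply]
        by_cases hsp : (s, p) ∈ A
        · rw [Set.indicator_of_mem hsp, walkKernel_apply,
            Measure.map_apply (measurable_walkStep _) hB]
          congr 1
          ext y
          simp [C, hsp]
        · rw [Set.indicator_of_notMem hsp]
          refine measure_mono_null (fun y hy => ?_) measure_empty
          exact absurd hy.1 hsp
    simp_rw [h3]
    rw [← lintegral_prod _ (hkm.indicator hA).aemeasurable, ← hlaw',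
      lintegral_map (hkm.indicator hA) (hW n), ← lintegral_indicator ((hW n) hA)]
    refine lintegral_congr fun ω => ?_
    simp only [Set.indicator, Set.mem_preimage, walkOfPast_past]
    rfl

end WalkState

/-- A criterion for a conditional probability in terms of the measures of intersections. -/
theorem condExp_eq_of_forall_measure_inter_eq {Ω : Type*} {m mΩ : MeasurableSpace Ω}
    {μ : Measure Ω} [IsProbabilityMeasure μ] (hle : m ≤ mΩ) {q : Ω → ℝ≥0∞}
    (hq : Measurable[m] q) (hq1 : ∀ ω, q ω ≤ 1) {D : Set Ω} (hD : MeasurableSet D)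
    (key : ∀ A, MeasurableSet[m] A → μ (A ∩ D) = ∫⁻ ω in A, q ω ∂μ) :
    μ⟦D | m⟧ =ᵐ[μ] fun ω => (q ω).toReal := by
  have hqr : Measurable[m] fun ω => (q ω).toReal := hq.ennreal_toReal
  have hqi : Integrable (fun ω => (q ω).toReal) μ :=
    Doeblin.integrable_of_mem_Icc (a := 0) (b := 1) (hqr.mono hle le_rfl) fun ω =>
      ⟨ENNReal.toReal_nonneg, by simpa using ENNReal.toReal_mono ENNReal.one_ne_top (hq1 ω)⟩
  refine (ae_eq_condExp_of_forall_setIntegral_eq hle ((integrable_const _).indicator hD)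
    (fun A _ _ => hqi.integrableOn) (fun A hA _ => ?_)
    hqr.stronglyMeasurable.aestronglyMeasurable).symm
  rw [setIntegral_indicator hD, setIntegral_const, smul_eq_mul, mul_one, measureReal_def, key A hA,
    integral_toReal (hq.mono hle le_rfl).aemeasurable
      (ae_of_all _ fun ω => (hq1 ω).trans_lt ENNReal.one_lt_top)]

section Crossing

variable {Ω : Type*} {M θlo θhi : ℝ} {X : ℕ → Ω → Set.Ici (-M)} {S₀ : Ω → ℝ}

/-- The down-crossing times of the walk. -/
def downAt (S₀ : Ω → ℝ) (X : ℕ → Ω → Set.Ici (-M)) (θlo θhi : ℝ) (n : ℕ) (ω : Ω) : ℕ∞ :=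
  downTime (walk (S₀ ω) fun k => (X k ω : ℝ)) θlo θhi n

/-- The up-crossing times of the walk. -/
def upAt (S₀ : Ω → ℝ) (X : ℕ → Ω → Set.Ici (-M)) (θlo θhi : ℝ) (n : ℕ) (ω : Ω) : ℕ∞ :=
  upTime (walk (S₀ ω) fun k => (X k ω : ℝ)) θlo θhi n

theorem upAt_succ (n : ℕ) : upAt S₀ X θlo θhi (n + 1) = fun ω =>
    firstHit (fun k => walkState S₀ X k ω ∈ above M θhi) (downAt S₀ X θlo θhi n ω) := rfl

theorem downAt_succ (n : ℕ) : downAt S₀ X θlo θhi (n + 1) = fun ω =>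
    firstHit (fun k => walkState S₀ X k ω ∈ below M θlo) (upAt S₀ X θlo θhi (n + 1) ω) := rfl

/-- The states at the two crossings of a cycle, with the time between them. -/
def cycleAt (S₀ : Ω → ℝ) (X : ℕ → Ω → Set.Ici (-M)) (θlo θhi : ℝ) (n : ℕ) (ω : Ω) :
    (Set.Ici (-M) × ℝ) × ((Set.Ici (-M) × ℝ) × ℕ) :=
  (atTime (walkState S₀ X) (upAt S₀ X θlo θhi n) ω,
    (atTime (walkState S₀ X) (downAt S₀ X θlo θhi n) ω,
      (downAt S₀ X θlo θhi n ω).toNat - (upAt S₀ X θlo θhi n ω).toNat))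

theorem crossingData_eq_cycleData (n : ℕ) (ω : Ω) :
    crossingData (S₀ ω) (fun k => (X k ω : ℝ)) θlo θhi n
      = cycleData (cycleAt S₀ X θlo θhi n ω) := rfl

theorem atTime_downAt_succ_mem (n : ℕ) {ω : Ω} (hω : downAt S₀ X θlo θhi (n + 1) ω ≠ ⊤) :
    atTime (walkState S₀ X) (downAt S₀ X θlo θhi (n + 1)) ω ∈ below M θlo := by
  obtain ⟨t, ht⟩ := ENat.ne_top_iff_exists.1 hω
  rw [atTime, ← ht, ENat.toNat_natCast]
  exact (firstHit_eq_coe_iff.1 ((congrFun (downAt_succ n) ω).symm.trans ht.symm)).2.1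

section Adapted

variable [mΩ : MeasurableSpace Ω] {μ : Measure Ω}
  {K : Kernel (Set.Ici (-M) × ℝ) (Set.Ici (-M) × ℝ)} {𝓕 : ℕ → MeasurableSpace Ω}

theorem measurableSet_downAt (h : IsAdaptedMarkov μ 𝓕 (walkState S₀ X) K) (n t : ℕ) :
    MeasurableSet[𝓕 t] {ω | downAt S₀ X θlo θhi n ω = t} := by
  induction n generalizing t with
  | zero =>
    change MeasurableSet[𝓕 t] {_ω : Ω | (0 : ℕ∞) = t}
    exact @MeasurableSet.const _ (𝓕 t) _
  | succ n ih =>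
    have h1 := measurableSet_firstHit h.mono (fun k => h.adapted k (measurableSet_above θhi)) ih
    exact measurableSet_firstHit h.mono (fun k => h.adapted k (measurableSet_below θlo)) h1 t

theorem measurableSet_upAt_succ (h : IsAdaptedMarkov μ 𝓕 (walkState S₀ X) K) (n t : ℕ) :
    MeasurableSet[𝓕 t] {ω | upAt S₀ X θlo θhi (n + 1) ω = t} :=
  measurableSet_firstHit h.mono (fun k => h.adapted k (measurableSet_above θhi))
    (measurableSet_downAt h n) t

theorem pastOf_downAt_le_pastOf_upAt (h : IsAdaptedMarkov μ 𝓕 (walkState S₀ X) K) (n : ℕ) :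
    pastOf 𝓕 (downAt S₀ X θlo θhi n) (measurableSet_downAt h n)
      ≤ pastOf 𝓕 (upAt S₀ X θlo θhi (n + 1)) (measurableSet_upAt_succ h n) :=
  fun _ hA t => measurableSet_inter_firstHit h.mono
    (fun k => h.adapted k (measurableSet_above θhi)) hA t

theorem pastOf_upAt_le_pastOf_downAt (h : IsAdaptedMarkov μ 𝓕 (walkState S₀ X) K) (n : ℕ) :
    pastOf 𝓕 (upAt S₀ X θlo θhi (n + 1)) (measurableSet_upAt_succ h n)
      ≤ pastOf 𝓕 (downAt S₀ X θlo θhi (n + 1)) (measurableSet_downAt h (n + 1)) :=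
  fun _ hA t => measurableSet_inter_firstHit h.mono
    (fun k => h.adapted k (measurableSet_below θlo)) hA t

theorem monotone_pastOf_downAt (h : IsAdaptedMarkov μ 𝓕 (walkState S₀ X) K) :
    Monotone fun n => pastOf 𝓕 (downAt S₀ X θlo θhi n) (measurableSet_downAt h n) :=
  monotone_nat_of_le_succ fun n =>
    (pastOf_downAt_le_pastOf_upAt h n).trans (pastOf_upAt_le_pastOf_downAt h n)

theorem measurable_cycleAt_succ (h : IsAdaptedMarkov μ 𝓕 (walkState S₀ X) K) (n : ℕ) :
    Measurable (cycleAt S₀ X θlo θhi (n + 1)) := by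
  have hL := fun t => h.le t _ (measurableSet_upAt_succ (θlo := θlo) (θhi := θhi) h n t)
  have hT := fun t => h.le t _ (measurableSet_downAt (θlo := θlo) (θhi := θhi) h (n + 1) t)
  exact (measurable_atTime h.measurable hL).prodMk ((measurable_atTime h.measurable hT).prodMk
    ((measurable_toNat_of_measurableSet hT).sub (measurable_toNat_of_measurableSet hL)))

theorem measurable_pastOf_cycleAt_succ (h : IsAdaptedMarkov μ 𝓕 (walkState S₀ X) K) (n : ℕ) :
    Measurable[pastOf 𝓕 (downAt S₀ X θlo θhi (n + 1)) (measurableSet_downAt h (n + 1))]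
      (cycleAt S₀ X θlo θhi (n + 1)) := by
  have hle := pastOf_upAt_le_pastOf_downAt (θlo := θlo) (θhi := θhi) h n
  have hL := measurableSet_upAt_succ (θlo := θlo) (θhi := θhi) h n
  have hT := measurableSet_downAt (θlo := θlo) (θhi := θhi) h (n + 1)
  have h1 := (measurable_pastOf_atTime h.adapted hL).mono hle le_rfl
  have h2 := measurable_pastOf_atTime h.adapted hT
  have h3 := (measurable_pastOf_toNat hL).mono hle le_rfl
  have h4 := measurable_pastOf_toNat hT
  exact Measurable.prodMk h1 (Measurable.prodMk h2 (Measurable.sub h4 h3))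

end Adapted

section Markov

variable [mΩ : MeasurableSpace Ω] {μ : Measure Ω} {P : Kernel (Set.Ici (-M)) (Set.Ici (-M))}
  {𝓕 : ℕ → MeasurableSpace Ω} [IsProbabilityMeasure μ]
  [IsMarkovKernel (hit (walkKernel P) (measurableSet_above (M := M) θhi))]

theorem ae_upAt_ne_top_of_downAt (h : IsAdaptedMarkov μ 𝓕 (walkState S₀ X) (walkKernel P))
    (n : ℕ) (hn : ∀ᵐ ω ∂μ, downAt S₀ X θlo θhi n ω ≠ ⊤) :
    ∀ᵐ ω ∂μ, upAt S₀ X θlo θhi (n + 1) ω ≠ ⊤ := by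
  rw [upAt_succ]
  exact h.ae_firstHit_ne_top (measurableSet_above θhi) (measurableSet_downAt h n) hn

variable [IsMarkovKernel (hit (walkKernel P) (measurableSet_below (M := M) θlo))]

theorem ae_downAt_ne_top (h : IsAdaptedMarkov μ 𝓕 (walkState S₀ X) (walkKernel P)) (n : ℕ) :
    ∀ᵐ ω ∂μ, downAt S₀ X θlo θhi n ω ≠ ⊤ := by
  induction n with
  | zero => exact ae_of_all _ fun ω => ENat.zero_ne_top
  | succ n ih =>
    rw [downAt_succ]
    exact h.ae_firstHit_ne_top (measurableSet_below θlo) (measurableSet_upAt_succ h n)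
      (ae_upAt_ne_top_of_downAt h n ih)

theorem ae_upAt_ne_top (h : IsAdaptedMarkov μ 𝓕 (walkState S₀ X) (walkKernel P)) (n : ℕ) :
    ∀ᵐ ω ∂μ, upAt S₀ X θlo θhi (n + 1) ω ≠ ⊤ :=
  ae_upAt_ne_top_of_downAt h n (ae_downAt_ne_top h n)

/-- Given the past of a down-crossing time, the next cycle has the law `cycle`. -/
theorem measure_cycleAt_succ (h : IsAdaptedMarkov μ 𝓕 (walkState S₀ X) (walkKernel P)) (n : ℕ)
    {A : Set Ω}
    (hA : MeasurableSet[pastOf 𝓕 (downAt S₀ X θlo θhi n) (measurableSet_downAt h n)] A)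
    {B : Set ((Set.Ici (-M) × ℝ) × ((Set.Ici (-M) × ℝ) × ℕ))} (hB : MeasurableSet B) :
    μ (A ∩ cycleAt S₀ X θlo θhi (n + 1) ⁻¹' B)
      = ∫⁻ ω in A, cycle P θlo θhi
        (atTime (walkState S₀ X) (downAt S₀ X θlo θhi n) ω) B ∂μ := by
  have hT := measurableSet_downAt (θlo := θlo) (θhi := θhi) h n
  have hL := measurableSet_upAt_succ (θlo := θlo) (θhi := θhi) h n
  have hTm := measurable_atTime h.measurable fun t => h.le t _ (hT t)
  have hLm := measurable_atTime h.measurable fun t => h.le t _ (hL t)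
  have hg := measurable_hit_slice (P := P) (θlo := θlo) hB
  have h1 : (μ.restrict A).map (fun ω => (atTime (walkState S₀ X) (downAt S₀ X θlo θhi n) ω,
      (atTime (walkState S₀ X) (upAt S₀ X θlo θhi (n + 1)) ω,
        (upAt S₀ X θlo θhi (n + 1) ω).toNat - (downAt S₀ X θlo θhi n ω).toNat)))
      = (μ.restrict A).map (atTime (walkState S₀ X) (downAt S₀ X θlo θhi n))
        ⊗ₘ hit (walkKernel P) (measurableSet_above (M := M) θhi) :=
    h.map_firstHit (measurableSet_above θhi) hT (ae_downAt_ne_top h n) hA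
  have h2 := h.map_firstHit (measurableSet_below θlo) hL (ae_upAt_ne_top h n)
    (pastOf_downAt_le_pastOf_upAt h n _ hA)
  have hV := measurable_cycleAt_succ (θlo := θlo) (θhi := θhi) h n
  have h3 : (μ.restrict A).map (cycleAt S₀ X θlo θhi (n + 1))
      = (μ.restrict A).map (atTime (walkState S₀ X) (upAt S₀ X θlo θhi (n + 1)))
        ⊗ₘ hit (walkKernel P) (measurableSet_below (M := M) θlo) := h2
  rw [Set.inter_comm, ← Measure.restrict_apply (hV hB), ← Measure.map_apply hV hB, h3,
    Measure.compProd_apply hB, lintegral_map hg hLm]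
  simp_rw [cycle_apply _ hB]
  set g := fun l => hit (walkKernel P) (measurableSet_below (M := M) θlo) l (Prod.mk l ⁻¹' B)
    with hgdef
  have hLn : Measurable fun ω => (atTime (walkState S₀ X) (upAt S₀ X θlo θhi (n + 1)) ω,
      (upAt S₀ X θlo θhi (n + 1) ω).toNat - (downAt S₀ X θlo θhi n ω).toNat) :=
    hLm.prodMk ((measurable_toNat_of_measurableSet fun t => h.le t _ (hL t)).sub
      (measurable_toNat_of_measurableSet fun t => h.le t _ (hT t)))
  have hg2 : Measurable fun q : (Set.Ici (-M) × ℝ) × ((Set.Ici (-M) × ℝ) × ℕ) => g q.2.1 :=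
    hg.comp (measurable_fst.comp measurable_snd)
  have h4 := congrArg (fun m => ∫⁻ q, g q.2.1 ∂m) h1
  beta_reduce at h4
  rw [Measure.lintegral_compProd hg2, lintegral_map hg2 (hTm.prodMk hLn)] at h4
  have hg1 : Measurable fun p : (Set.Ici (-M) × ℝ) × ℕ => g p.1 := hg.comp measurable_fst
  exact h4.trans (lintegral_map hg1.lintegral_kernel hTm)

variable [IsMarkovKernel P]

theorem ae_cycleData_mem (h : IsAdaptedMarkov μ 𝓕 (walkState S₀ X) (walkKernel P))
    (hlt : θlo < θhi) (n : ℕ) :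
    ∀ᵐ ω ∂μ, cycleData (cycleAt S₀ X θlo θhi (n + 2) ω) ∈ crossingSpace M θlo θhi := by
  have hB := measurable_cycleData (M := M) (measurableSet_crossingSpace (M := M) (θlo := θlo)
    (θhi := θhi)).compl
  have h1 := measure_cycleAt_succ (θlo := θlo) (θhi := θhi) h (n + 1) (A := Set.univ)
    MeasurableSet.univ hB
  rw [Set.univ_inter, Measure.restrict_univ] at h1
  refine h1.trans ?_
  rw [lintegral_eq_zero_iff' ]
  · filter_upwards [ae_downAt_ne_top (θlo := θlo) (θhi := θhi) h (n + 1)] with ω hω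
    refine cycle_crossingSpace_compl hlt fun h' => ?_
    have h2 := atTime_downAt_succ_mem n hω
    simp only [above, below, Set.mem_ofPred_eq] at h' h2
    linarith
  · exact ((Kernel.measurable_coe _ hB).comp (measurable_atTime h.measurable
      fun t => h.le t _ (measurableSet_downAt h (n + 1) t))).aemeasurable

theorem isMarkovChain_cycleData (h : IsAdaptedMarkov μ 𝓕 (walkState S₀ X) (walkKernel P))
    (hlt : θlo < θhi) :
    IsMarkovChain μ (fun n ω => cycleData (cycleAt S₀ X θlo θhi (n + 2) ω))
      (crossingKernel P θlo θhi) := by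
  have hm : ∀ n, Measurable fun ω => cycleData (cycleAt S₀ X θlo θhi (n + 2) ω) := fun n =>
    measurable_cycleData.comp (measurable_cycleAt_succ h (n + 1))
  refine ⟨hm, fun n B hB => ?_⟩
  refine condExp_eq_of_forall_measure_inter_eq (iSup₂_le fun i _ => (hm i).comap_le)
    ((Kernel.measurable_coe _ hB).comp ((comap_measurable _).mono
      (le_iSup₂ (f := fun i (_ : i ∈ Set.Iic n) => MeasurableSpace.comap
        (fun ω => cycleData (cycleAt S₀ X θlo θhi (i + 2) ω)) inferInstance) n
        (Set.mem_Iic.2 le_rfl)) le_rfl))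
    (fun ω => prob_le_one) (hm (n + 1) hB) fun A hA => ?_
  have hle' : ⨆ i ∈ Set.Iic n, MeasurableSpace.comap
      (fun ω => cycleData (cycleAt S₀ X θlo θhi (i + 2) ω)) inferInstance
      ≤ pastOf 𝓕 (downAt S₀ X θlo θhi (n + 2)) (measurableSet_downAt h (n + 2)) :=
    iSup₂_le fun i hi => (measurable_cycleData.comp
      (measurable_pastOf_cycleAt_succ h (i + 1))).comap_le.trans
        (monotone_pastOf_downAt h (Nat.add_le_add_right hi 2))
  have hA' : MeasurableSet A :=
    (iSup₂_le fun i _ => (hm i).comap_le : (⨆ i ∈ Set.Iic n, MeasurableSpace.comap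
      (fun ω => cycleData (cycleAt S₀ X θlo θhi (i + 2) ω)) inferInstance) ≤ mΩ) A hA
  refine (measure_cycleAt_succ h (n + 2) (hle' _ hA) (measurable_cycleData hB)).trans ?_
  refine (setLIntegral_congr_fun_ae hA' ?_).symm
  filter_upwards [ae_cycleData_mem h hlt n] with ω hω _
  rw [Function.comp_apply, crossingKernel_apply P _ hB, endState_cycleData hω]
  rfl

end Markov

end Crossing

end

end LevelCrossing

open LevelCrossing

theorem theorem2p6 {Ω : Type*} [MeasurableSpace Ω] (μ : Measure Ω) [IsProbabilityMeasure μ]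
    (M : ℝ) (hM : 0 < M)
    (P : Kernel (Set.Ici (-M)) (Set.Ici (-M))) [IsMarkovKernel P]
    (X : ℕ → Ω → Set.Ici (-M)) (hX : LevelCrossing.IsMarkovChain μ X P)
    (S₀ : Ω → ℝ) (hS₀ : Measurable S₀) (hindep : IndepFun S₀ (fun ω k => X k ω) μ)
    (hsq : ∀ n : ℕ, 1 ≤ n → Integrable (fun ω => (X n ω : ℝ) ^ 2) μ)
    (hminor : LevelCrossing.Minorized P) (hmean : LevelCrossing.ZeroMean P)
    (θlo θhi : ℝ) (hlo : θlo < 0) (hhi : 0 < θhi)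
    (S : Ω → ℕ → ℝ) (hS : ∀ ω, S ω = LevelCrossing.walk (S₀ ω) (fun k => (X k ω : ℝ)))
    (U : ℕ → Ω → ℝ × ℝ × ℝ × ℝ × ℕ)
    (hU : ∀ n ω, U n ω = LevelCrossing.crossingData (S₀ ω) (fun k => (X k ω : ℝ)) θlo θhi n) :
    -- the crossing times are almost surely finite
    (∀ᵐ ω ∂μ, ∀ n : ℕ, 1 ≤ n → LevelCrossing.upTime (S ω) θlo θhi n ≠ ⊤ ∧
      LevelCrossing.downTime (S ω) θlo θhi n ≠ ⊤) ∧
    -- the crossing data from index `2` on form a homogeneous Markov chain on the state space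
    (∀ᵐ ω ∂μ, ∀ n : ℕ, 2 ≤ n → U n ω ∈ LevelCrossing.crossingSpace M θlo θhi) ∧
    (∃ Q : Kernel (ℝ × ℝ × ℝ × ℝ × ℕ) (ℝ × ℝ × ℝ × ℝ × ℕ), IsMarkovKernel Q ∧
      (∀ y ∈ LevelCrossing.crossingSpace M θlo θhi,
        Q y (LevelCrossing.crossingSpace M θlo θhi) = 1) ∧
      LevelCrossing.IsMarkovChain μ (fun n => U (n + 2)) Q) ∧
    -- geometric convergence in total variation, and the strong law of large numbers
    ∃ υ : Measure (ℝ × ℝ × ℝ × ℝ × ℕ), IsProbabilityMeasure υ ∧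
      υ (LevelCrossing.crossingSpace M θlo θhi) = 1 ∧
      LevelCrossing.GeometricTV (fun n => μ.map (U n)) υ ∧
      ∀ φ : ℝ × ℝ × ℝ × ℝ × ℕ → ℝ, Measurable φ →
        (∃ K : ℝ, ∀ y ∈ LevelCrossing.crossingSpace M θlo θhi, |φ y| ≤ K) →
        ∀ᵐ ω ∂μ, Tendsto (fun n : ℕ => (∑ j ∈ Finset.Icc 1 n, φ (U j ω)) / (n : ℝ)) atTop
          (𝓝 (∫ y, φ y ∂υ)) := by
  have hlt : θlo < θhi := hlo.trans hhi
  have := isMarkovKernel_hit_above hM hminor hmean θhi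
  have := isMarkovKernel_hit_below hM hminor hmean θlo
  have h := isAdaptedMarkov_walkState hX hS₀ hindep
  have hUeq : U = fun n ω => cycleData (cycleAt S₀ X θlo θhi n ω) :=
    funext₂ fun n ω => (hU n ω).trans (crossingData_eq_cycleData n ω)
  have hchain : IsMarkovChain μ (fun n => U (n + 2)) (crossingKernel P θlo θhi) := by
    rw [hUeq]
    exact isMarkovChain_cycleData h hlt
  have hspace : ∀ᵐ ω ∂μ, ∀ n : ℕ, U (n + 2) ω ∈ crossingSpace M θlo θhi := by
    rw [hUeq]
    exact ae_all_iff.2 fun n => ae_cycleData_mem h hlt n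
  have hQ := crossingKernel_crossingSpace (P := P) hM.le hlt
  obtain ⟨ε, ν, hν, hε0, hε1, hle⟩ := exists_smul_le_crossingKernel (P := P) hM hminor hlo hhi
  obtain ⟨υ, hυ, hinv, -⟩ := Doeblin.exists_invariant _ ν hε0 hε1 hle
  have hυ1 : υ (crossingSpace M θlo θhi) = 1 := by
    rw [← hinv, Measure.bind_apply measurableSet_crossingSpace (Kernel.aemeasurable _)]
    simp_rw [hQ]
    simp
  refine ⟨?_, ?_, ⟨_, inferInstance, fun y _ => hQ y, hchain⟩, υ, hυ, hυ1, ?_, ?_⟩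
  · filter_upwards [ae_all_iff.2 fun n => ae_upAt_ne_top h (θlo := θlo) (θhi := θhi) n,
      ae_all_iff.2 fun n => ae_downAt_ne_top h (θlo := θlo) (θhi := θhi) n] with ω h1 h2 n hn
    obtain ⟨m, rfl⟩ := Nat.exists_eq_add_of_le' hn
    rw [hS]
    exact ⟨h1 m, h2 (m + 1)⟩
  · filter_upwards [hspace] with ω hω n hn
    obtain ⟨m, rfl⟩ := Nat.exists_eq_add_of_le' hn
    exact hω m
  · set r : ℝ := max (1 - ε.toReal) (1 / 2) with hr
    have hεpos : 0 < ε.toReal :=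
      ENNReal.toReal_pos hε0 (ne_top_of_le_ne_top ENNReal.one_ne_top hε1)
    have hεle : ε.toReal ≤ 1 := by simpa using ENNReal.toReal_mono ENNReal.one_ne_top hε1
    have hr0 : 0 < r := lt_of_lt_of_le one_half_pos (le_max_right _ _)
    refine ⟨(r ^ 2)⁻¹, r, hr0, max_lt (by linarith) one_half_lt_one, fun n hn B hB => ?_⟩
    obtain ⟨m, rfl⟩ := Nat.exists_eq_add_of_le' hn
    have h1 := Doeblin.abs_measureReal_sub_le hle hinv (m := fun n => μ.map (U (n + 2)))
      (fun n => Measure.isProbabilityMeasure_map (hchain.measurable n).aemeasurable)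
      (fun n => hchain.map_succ n) hB m
    refine h1.trans ((pow_le_pow_left₀ (by linarith) (le_max_left _ (1 / 2 : ℝ)) m).trans_eq ?_)
    rw [← hr, pow_add]
    field_simp
  · rintro φ hφ ⟨C, hC⟩
    set ψ := (crossingSpace M θlo θhi).indicator φ with hψ
    have hψm : Measurable ψ := hφ.indicator measurableSet_crossingSpace
    have hψb : ∀ y, ψ y ∈ Set.Icc (-|C|) |C| := fun y => abs_le.1 (by
      by_cases hy : y ∈ crossingSpace M θlo θhi
      · rw [hψ, Set.indicator_of_mem hy]
        exact (hC y hy).trans (le_abs_self C)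
      · rw [hψ, Set.indicator_of_notMem hy, abs_zero]
        exact abs_nonneg C)
    have hint : ∫ y, ψ y ∂υ = ∫ y, φ y ∂υ := by
      refine integral_congr_ae ?_
      have : ∀ᵐ y ∂υ, y ∈ crossingSpace M θlo θhi :=
        (prob_compl_eq_zero_iff measurableSet_crossingSpace).2 hυ1
      filter_upwards [this] with y hy
      rw [hψ, Set.indicator_of_mem hy]
    filter_upwards [hchain.strong_law hle hε0 hε1 hinv hψm hψb, hspace] with ω hω hsp
    rw [hint] at hω
    have h1 : Tendsto (fun n : ℕ => (n : ℝ) / ((n : ℝ) + 1)) atTop (𝓝 1) :=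
      tendsto_natCast_div_add_atTop 1
    have h2 : Tendsto (fun n : ℕ => φ (U 1 ω) / ((n + 1 : ℕ) : ℝ)) atTop (𝓝 0) :=
      (tendsto_add_atTop_iff_nat 1).2 (tendsto_const_div_atTop_nhds_zero_nat _)
    have h3 := h2.add (hω.mul h1)
    rw [zero_add, mul_one] at h3
    refine (tendsto_add_atTop_iff_nat 1).1 (h3.congr' ?_)
    filter_upwards [eventually_ge_atTop 1] with n hn
    have hn0 : (n : ℝ) ≠ 0 := by positivity
    have hsum : ∀ n : ℕ, ∑ j ∈ Finset.Icc 1 (n + 1), φ (U j ω)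
        = φ (U 1 ω) + ∑ j ∈ Finset.range n, ψ (U (j + 2) ω) := fun n => by
      induction n with
      | zero => simp
      | succ n ih =>
        rw [Finset.sum_Icc_succ_top (by lia), ih, Finset.sum_range_succ, add_assoc,
          hψ, Set.indicator_of_mem (hsp n)]
    rw [hsum]
    push_cast
    field_simp
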